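/- **Setting (two-level co-kriging model).** Let $D\subseteq\mathbb R^d$, let $f_1:D\to\mathbb R^{p_1}$, $f_2:D\to\mathbb R^{p_2}$ be vectors of regression functions and let $(x,x')\mapsto r_t(x-x')$, $t=1,2$, be correlation functions on $D$ (hyper-parameters are fixed). Given the parameters $(\sigma_1^2,\beta_1,\sigma_2^2,\rho,\beta_2)$ with $\sigma_1^2,\sigma_2^2>0$, $\beta_1\in\mathbb R^{p_1}$, $\rho\in\mathbb R$, $\beta_2\in\mathbb R^{p_2}$, the processes $Z_1$ and $\delta$ on $D$ are independent Gaussian processes with means $f_1(x)^T\beta_1$, $f_2(x)^T\beta_2$ and covariances $\sigma_1^2r_1(x-x')$, $\sigma_2^2r_2(x-x')$, and $Z_2(x)=\rho Z_1(x)+\delta(x)$. Let $D_1=(x^{(1)}_1,\dots,x^{(1)}_{n_1})$ and $D_2=(x^{(2)}_1,\dots,x^{(2)}_{n_2})$ be designs in $D$ with $D_2\subseteq D_1$, let $z_1=Z_1(D_1)$, $z_2=Z_2(D_2)$, let $z_1(D_2)$ be the vector of those entries of $z_1$ that belong to the points of $D_2$, let $F_t$ be the matrix with rows $f_t(x_i^{(t)})^T$,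 let $R_t=[r_t(x_i^{(t)}-x_j^{(t)})]_{i,j}$ be positive definite, and put $\lambda=(\rho,\beta_2)$ and $F=[\,z_1(D_2)\;\;F_2\,]$ (an $n_2\times(1+p_2)$ matrix depending on $z_1$). $\mathcal{IG}(\alpha,q)$ is the distribution with density $\frac{q^\alpha}{\Gamma(\alpha)}\frac{e^{-q/x}}{x^{\alpha+1}}1_{x>0}$. The joint density of the observations given the parameters is $p(z_1|\beta_1,\sigma_1^2)\,p(z_2|z_1,\lambda,\sigma_2^2)$, where $p(z_1|\beta_1,\sigma_1^2)$ is the density of $\mathcal N(F_1\beta_1,\sigma_1^2R_1)$ at $z_1$ and $p(z_2|z_1,\lambda,\sigma_2^2)$ that of $\mathcal N(F\lambda,\sigma_2^2R_2)$ at $z_2$. **Priors.** Case (I), informative: $[\beta_1|\sigma_1^2]\sim\mathcal N(b_1,\sigma_1^2V_1)$, $[\sigma_1^2]\sim\mathcal{IG}(\alpha_1,\gamma_1)$, $[\lambda|z_1,\sigma_2^2]\sim\mathcal N(b_\lambda,\sigma_2^2V_\lambda)$, $[\sigma_2^2|z_1]\sim\mathcal{IG}(\alpha_2,\gamma_2)$,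 where $V_1,V_\lambda$ are diagonal with positive diagonal entries and $\alpha_1,\gamma_1,\alpha_2,\gamma_2>0$. Case (II), non-informative (improper) Jeffreys priors: $p(\beta_1|\sigma_1^2)\propto1$, $p(\sigma_1^2)\propto1/\sigma_1^2$, $p(\lambda|z_1,\sigma_2^2)\propto1$, $p(\sigma_2^2|z_1)\propto1/\sigma_2^2$; posteriors are then defined by the Bayes formula, i.e. as the normalized product of likelihood and prior. **Claim.** For $i\in\{\mathrm{I},\mathrm{II}\}$, $$[\beta_1|z_1,\sigma_1^2]\sim\mathcal N(A_i^1\nu_i^1,A_i^1),\quad[(\rho,\beta_2)|z_1,z_2,\sigma_2^2]\sim\mathcal N(A_i^\lambda\nu_i^\lambda,A_i^\lambda),$$ $$[\sigma_1^2|z_1]\sim\mathcal{IG}\big(\alpha_i^{\sigma_1^2|n_1},Q_i^1/2\big),\quad[\sigma_2^2|z_1,z_2]\sim\mathcal{IG}\big(\alpha_i^{\sigma_2^2|n_2},Q_i^2/2\big),$$ with $$A_{\mathrm I}^1=\Big[F_1^T\tfrac{R_1^{-1}}{\sigma_1^2}F_1+\tfrac{V_1^{-1}}{\sigma_1^2}\Big]^{-1},\quad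 A_{\mathrm{II}}^1=\Big[F_1^T\tfrac{R_1^{-1}}{\sigma_1^2}F_1\Big]^{-1},\quad\nu_{\mathrm I}^1=F_1^T\tfrac{R_1^{-1}}{\sigma_1^2}z_1+\tfrac{V_1^{-1}}{\sigma_1^2}b_1,\quad\nu_{\mathrm{II}}^1=F_1^T\tfrac{R_1^{-1}}{\sigma_1^2}z_1,$$ $$A_{\mathrm I}^\lambda=\Big[F^T\tfrac{R_2^{-1}}{\sigma_2^2}F+\tfrac{V_\lambda^{-1}}{\sigma_2^2}\Big]^{-1},\quad A_{\mathrm{II}}^\lambda=\Big[F^T\tfrac{R_2^{-1}}{\sigma_2^2}F\Big]^{-1},\quad\nu_{\mathrm I}^\lambda=F^T\tfrac{R_2^{-1}}{\sigma_2^2}z_2+\tfrac{V_\lambda^{-1}}{\sigma_2^2}b_\lambda,\quad\nu_{\mathrm{II}}^\lambda=F^T\tfrac{R_2^{-1}}{\sigma_2^2}z_2,$$ $$\hat\beta_1=(F_1^TR_1^{-1}F_1)^{-1}F_1^TR_1^{-1}z_1,\qquad\hat\lambda=(F^TR_2^{-1}F)^{-1}F^TR_2^{-1}z_2,$$ $$Q_{\mathrm{II}}^1=z_1^T\big[R_1^{-1}-R_1^{-1}F_1(F_1^TR_1^{-1}F_1)^{-1}F_1^TR_1^{-1}\big]z_1,\qquad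 Q_{\mathrm{II}}^2=z_2^T\big[R_2^{-1}-R_2^{-1}F(F^TR_2^{-1}F)^{-1}F^TR_2^{-1}\big]z_2,$$ $$Q_{\mathrm I}^1=2\gamma_1+(b_1-\hat\beta_1)^T\big(V_1+[F_1^TR_1^{-1}F_1]^{-1}\big)^{-1}(b_1-\hat\beta_1)+Q_{\mathrm{II}}^1,$$ $$Q_{\mathrm I}^2=2\gamma_2+(b_\lambda-\hat\lambda)^T\big(V_\lambda+[F^TR_2^{-1}F]^{-1}\big)^{-1}(b_\lambda-\hat\lambda)+Q_{\mathrm{II}}^2,$$ $$\alpha_{\mathrm I}^{\sigma_1^2|n_1}=\tfrac{n_1}2+\alpha_1,\quad\alpha_{\mathrm{II}}^{\sigma_1^2|n_1}=\tfrac{n_1-p_1}2,\quad\alpha_{\mathrm I}^{\sigma_2^2|n_2}=\tfrac{n_2}2+\alpha_2,\quad\alpha_{\mathrm{II}}^{\sigma_2^2|n_2}=\tfrac{n_2-p_2-1}2.$$ In case (I) these are conditional distributions, valid for almost every value of the conditioning variables; the inverse-gamma formulas are asserted where $F_1$, respectively $F=F(z_1)$, has linearly independent columns. In case (II) they hold for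 all observations $z_1$, respectively $(z_1,z_2)$, such that $F_1$, respectively $F$, has linearly independent columns and, for the inverse-gamma formulas, $z_1$, respectively $z_2$, is not in the column space of that matrix; the normalizing constants in the Bayes formula are then finite and positive. -/

import Mathlib

open MeasureTheory ProbabilityTheory Matrix
open scoped ENNReal

noncomputable section

namespace CoKriging

/-- Density of the inverse gamma distribution with shape `α` and scale `q`. -/
def invGammaPDF (α q x : ℝ) : ℝ :=
  if 0 < x then q ^ α / Real.Gamma α * (Real.exp (-(q / x)) / x ^ (α + 1)) else 0

/-- The inverse gamma distribution on the real line. -/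
def invGamma (α q : ℝ) : Measure ℝ :=
  volume.withDensity fun x => ENNReal.ofReal (invGammaPDF α q x)

section Regression

variable {ι κ : Type*} [Fintype ι] [DecidableEq ι] [Fintype κ] [DecidableEq κ]

/-- The quadratic form `vᵀ M v`. -/
def quad (M : Matrix ι ι ℝ) (v : EuclideanSpace ℝ ι) : ℝ :=
  v.ofLp ⬝ᵥ (M *ᵥ v.ofLp)

/-- The product `M v`, as a Euclidean vector. -/
def mulE (M : Matrix ι κ ℝ) (v : EuclideanSpace ℝ κ) : EuclideanSpace ℝ ι :=
  WithLp.toLp 2 (M *ᵥ v.ofLp)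

/-- Lebesgue density at `z` of the Gaussian distribution with mean `m` and (positive definite)
covariance `S`. -/
def gaussDensity (m : EuclideanSpace ℝ ι) (S : Matrix ι ι ℝ) (z : EuclideanSpace ℝ ι) : ℝ :=
  (Real.sqrt ((2 * Real.pi) ^ Fintype.card ι * S.det))⁻¹ * Real.exp (-(1 / 2) * quad S⁻¹ (z - m))

/-! In the following, `F` is the design matrix (`ι` indexes the observations and `κ` the
regression coefficients), `R` the correlation matrix of the observations, `z` the observations,
`s` the variance, `b` and `s V` the prior mean and covariance of the coefficients. -/

/-- `A` in the informative case: `[Fᵀ (R⁻¹/s) F + V⁻¹/s]⁻¹`. -/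
def covI (F : Matrix ι κ ℝ) (R : Matrix ι ι ℝ) (V : Matrix κ κ ℝ) (s : ℝ) : Matrix κ κ ℝ :=
  (Fᵀ * (s⁻¹ • R⁻¹) * F + s⁻¹ • V⁻¹)⁻¹

/-- `A` in the non-informative case: `[Fᵀ (R⁻¹/s) F]⁻¹`. -/
def covII (F : Matrix ι κ ℝ) (R : Matrix ι ι ℝ) (s : ℝ) : Matrix κ κ ℝ :=
  (Fᵀ * (s⁻¹ • R⁻¹) * F)⁻¹

/-- `ν` in the informative case: `Fᵀ (R⁻¹/s) z + (V⁻¹/s) b`. -/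
def nuI (F : Matrix ι κ ℝ) (R : Matrix ι ι ℝ) (V : Matrix κ κ ℝ) (b : EuclideanSpace ℝ κ)
    (z : EuclideanSpace ℝ ι) (s : ℝ) : EuclideanSpace ℝ κ :=
  mulE (Fᵀ * (s⁻¹ • R⁻¹)) z + mulE (s⁻¹ • V⁻¹) b

/-- `ν` in the non-informative case: `Fᵀ (R⁻¹/s) z`. -/
def nuII (F : Matrix ι κ ℝ) (R : Matrix ι ι ℝ) (z : EuclideanSpace ℝ ι) (s : ℝ) :
    EuclideanSpace ℝ κ :=
  mulE (Fᵀ * (s⁻¹ • R⁻¹)) z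

/-- The generalized least squares estimator `(Fᵀ R⁻¹ F)⁻¹ Fᵀ R⁻¹ z`. -/
def gls (F : Matrix ι κ ℝ) (R : Matrix ι ι ℝ) (z : EuclideanSpace ℝ ι) : EuclideanSpace ℝ κ :=
  mulE ((Fᵀ * R⁻¹ * F)⁻¹ * Fᵀ * R⁻¹) z

/-- `Q` in the non-informative case: `zᵀ [R⁻¹ - R⁻¹ F (Fᵀ R⁻¹ F)⁻¹ Fᵀ R⁻¹] z`. -/
def scaleII (F : Matrix ι κ ℝ) (R : Matrix ι ι ℝ) (z : EuclideanSpace ℝ ι) : ℝ :=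
  quad (R⁻¹ - R⁻¹ * F * (Fᵀ * R⁻¹ * F)⁻¹ * Fᵀ * R⁻¹) z

/-- `Q` in the informative case:
`2 γ + (b - gls)ᵀ (V + [Fᵀ R⁻¹ F]⁻¹)⁻¹ (b - gls)` plus the non-informative `Q`. -/
def scaleI (F : Matrix ι κ ℝ) (R : Matrix ι ι ℝ) (V : Matrix κ κ ℝ) (b : EuclideanSpace ℝ κ)
    (γ : ℝ) (z : EuclideanSpace ℝ ι) : ℝ :=
  2 * γ + quad (V + (Fᵀ * R⁻¹ * F)⁻¹)⁻¹ (b - gls F R z) + scaleII F R z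

end Regression

/-- The marginal likelihood of a likelihood function `L` under a (possibly improper) prior. -/
def evidence {Θ : Type*} [MeasurableSpace Θ] (prior : Measure Θ) (L : Θ → ℝ) : ℝ≥0∞ :=
  ∫⁻ θ, ENNReal.ofReal (L θ) ∂prior

/-- The posterior distribution by the Bayes formula: likelihood times (possibly improper) prior,
normalized. It is meaningful when the evidence is neither zero nor infinite. -/
def bayes {Θ : Type*} [MeasurableSpace Θ] (prior : Measure Θ) (L : Θ → ℝ) : Measure Θ :=
  (evidence prior L)⁻¹ • prior.withDensity fun θ => ENNReal.ofReal (L θ)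

/-- The Jeffreys prior `p(s) ∝ 1 / s` on the positive half line. -/
def jeffreys : Measure ℝ :=
  (volume.restrict (Set.Ioi 0)).withDensity fun s => ENNReal.ofReal (1 / s)

section Model

variable {d : ℕ} {D : Set (EuclideanSpace ℝ (Fin d))}

/-- `(x, x') ↦ r (x - x')` is a correlation function on the input domain `D`. -/
def IsCorrelation (D : Set (EuclideanSpace ℝ (Fin d))) (r : EuclideanSpace ℝ (Fin d) → ℝ) : Prop :=
  r 0 = 1 ∧ ∀ (n : ℕ) (x : Fin n → D),
    (Matrix.of fun i j => r ((x i : EuclideanSpace ℝ (Fin d)) - x j)).PosSemidef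

/-- The correlation matrix of a design. -/
def corr (r : EuclideanSpace ℝ (Fin d) → ℝ) {n : ℕ} (x : Fin n → D) : Matrix (Fin n) (Fin n) ℝ :=
  Matrix.of fun i j => r ((x i : EuclideanSpace ℝ (Fin d)) - x j)

/-- The design matrix whose rows are the regression functions at the design points. -/
def design {p : ℕ} (f : D → Fin p → ℝ) {n : ℕ} (x : Fin n → D) : Matrix (Fin n) (Fin p) ℝ :=
  Matrix.of fun i k => f (x i) k

/-- The level-two design matrix `[z₁(D₂)  F₂]`, where the `i`-th point of the second design is
the `e i`-th point of the first one. -/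
def design₂ {p n₁ n₂ : ℕ} (f₂ : D → Fin p → ℝ) (x₂ : Fin n₂ → D) (e : Fin n₂ → Fin n₁)
    (z₁ : EuclideanSpace ℝ (Fin n₁)) : Matrix (Fin n₂) (Unit ⊕ Fin p) ℝ :=
  Matrix.of fun i => Sum.elim (fun _ => z₁ (e i)) (fun k => f₂ (x₂ i) k)

/-- The values of a process at the points of a design. -/
def sample {Ω : Type*} (Z : D → Ω → ℝ) {n : ℕ} (x : Fin n → D) (ω : Ω) : EuclideanSpace ℝ (Fin n) :=
  WithLp.toLp 2 fun i => Z (x i) ω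

/-- The coefficient `ρ` of `λ = (ρ, β₂)`. -/
def rho {p : ℕ} (l : EuclideanSpace ℝ (Unit ⊕ Fin p)) : ℝ := l (Sum.inl ())

/-- The coefficient `β₂` of `λ = (ρ, β₂)`. -/
def beta₂ {p : ℕ} (l : EuclideanSpace ℝ (Unit ⊕ Fin p)) : EuclideanSpace ℝ (Fin p) :=
  WithLp.toLp 2 fun k => l (Sum.inr k)

/-- The parameters `(σ₁², β₁, σ₂², (ρ, β₂))`. -/
abbrev Param (p₁ p₂ : ℕ) : Type :=
  ℝ × EuclideanSpace ℝ (Fin p₁) × ℝ × EuclideanSpace ℝ (Unit ⊕ Fin p₂)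

/-- The law of `(Z₁(x), δ(y))` given the parameters, for finitely many points `x` and `y`, when
`Z₁` and `δ` are independent Gaussian processes with means `f₁ᵀ β₁` and `f₂ᵀ β₂` and covariance
functions `σ₁² r₁` and `σ₂² r₂`. -/
def pairLaw {p₁ p₂ : ℕ} (f₁ : D → Fin p₁ → ℝ) (f₂ : D → Fin p₂ → ℝ)
    (r₁ r₂ : EuclideanSpace ℝ (Fin d) → ℝ) {m n : ℕ} (x : Fin m → D) (y : Fin n → D)
    (θ : Param p₁ p₂) : Measure (EuclideanSpace ℝ (Fin m) × EuclideanSpace ℝ (Fin n)) :=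
  (multivariateGaussian (mulE (design f₁ x) θ.2.1) (θ.1 • corr r₁ x)).prod
    (multivariateGaussian (mulE (design f₂ y) (beta₂ θ.2.2.2)) (θ.2.2.1 • corr r₂ y))

/-- The two-level model with known parameters `θ`: under `P`, `Z₁` and `δ` are independent
Gaussian processes (with the means and covariances determined by `θ`), and `Z₂ = ρ Z₁ + δ`. -/
structure FixedModel {Ω : Type*} [MeasurableSpace Ω] (P : Measure Ω) {p₁ p₂ : ℕ}
    (f₁ : D → Fin p₁ → ℝ) (f₂ : D → Fin p₂ → ℝ) (r₁ r₂ : EuclideanSpace ℝ (Fin d) → ℝ)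
    (θ : Param p₁ p₂) (Z₁ Z₂ δ : D → Ω → ℝ) : Prop where
  measurable_Z₁ : ∀ x, Measurable (Z₁ x)
  measurable_δ : ∀ x, Measurable (δ x)
  autoregressive : ∀ x ω, Z₂ x ω = rho θ.2.2.2 * Z₁ x ω + δ x ω
  law : ∀ (m n : ℕ) (x : Fin m → D) (y : Fin n → D),
    P.map (fun ω => (sample Z₁ x ω, sample δ y ω)) = pairLaw f₁ f₂ r₁ r₂ x y θ

/-- The two-level model with random parameters `(σ₁², β₁, σ₂², (ρ, β₂)) = (s₁, β₁, s₂, l)`: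
conditionally on the parameters, `Z₁` and `δ` are independent Gaussian processes (with the means
and covariances determined by the parameters), and `Z₂ = ρ Z₁ + δ`. -/
structure RandomModel {Ω : Type*} [MeasurableSpace Ω] (P : Measure Ω) [IsFiniteMeasure P]
    {p₁ p₂ : ℕ} (f₁ : D → Fin p₁ → ℝ) (f₂ : D → Fin p₂ → ℝ)
    (r₁ r₂ : EuclideanSpace ℝ (Fin d) → ℝ)
    (s₁ : Ω → ℝ) (β₁ : Ω → EuclideanSpace ℝ (Fin p₁))
    (s₂ : Ω → ℝ) (l : Ω → EuclideanSpace ℝ (Unit ⊕ Fin p₂))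
    (Z₁ Z₂ δ : D → Ω → ℝ) : Prop where
  measurable_s₁ : Measurable s₁
  measurable_β₁ : Measurable β₁
  measurable_s₂ : Measurable s₂
  measurable_l : Measurable l
  measurable_Z₁ : ∀ x, Measurable (Z₁ x)
  measurable_δ : ∀ x, Measurable (δ x)
  autoregressive : ∀ x ω, Z₂ x ω = rho (l ω) * Z₁ x ω + δ x ω
  law : ∀ (m n : ℕ) (x : Fin m → D) (y : Fin n → D),
    condDistrib (fun ω => (sample Z₁ x ω, sample δ y ω)) (fun ω => (s₁ ω, β₁ ω, s₂ ω, l ω)) P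
      =ᵐ[P.map fun ω => (s₁ ω, β₁ ω, s₂ ω, l ω)] pairLaw f₁ f₂ r₁ r₂ x y

/-- The informative conjugate priors for the two levels, where `V₁` and `V_λ` are the diagonal
matrices with diagonals `v₁` and `vl`, and `z₁` is the sample of the first level. -/
structure InformativePriors {Ω : Type*} [MeasurableSpace Ω] (P : Measure Ω) [IsFiniteMeasure P]
    {p₁ p₂ n₁ : ℕ}
    (s₁ : Ω → ℝ) (β₁ : Ω → EuclideanSpace ℝ (Fin p₁))
    (s₂ : Ω → ℝ) (l : Ω → EuclideanSpace ℝ (Unit ⊕ Fin p₂))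
    (z₁ : Ω → EuclideanSpace ℝ (Fin n₁))
    (b₁ : EuclideanSpace ℝ (Fin p₁)) (v₁ : Fin p₁ → ℝ) (α₁ γ₁ : ℝ)
    (bl : EuclideanSpace ℝ (Unit ⊕ Fin p₂)) (vl : Unit ⊕ Fin p₂ → ℝ) (α₂ γ₂ : ℝ) : Prop where
  prior_s₁ : P.map s₁ = invGamma α₁ γ₁
  prior_β₁ : condDistrib β₁ s₁ P =ᵐ[P.map s₁]
    fun s => multivariateGaussian b₁ (s • Matrix.diagonal v₁)
  prior_s₂ : condDistrib s₂ z₁ P =ᵐ[P.map z₁] fun _ => invGamma α₂ γ₂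
  prior_l : condDistrib l (fun ω => (z₁ ω, s₂ ω)) P =ᵐ[P.map fun ω => (z₁ ω, s₂ ω)]
    fun y => multivariateGaussian bl (y.2 • Matrix.diagonal vl)

end Model

end CoKriging

end

/-!
Both levels are instances of one regression model: given the variance `s`, the observations `z` are
Gaussian with mean `F β` and covariance `s R`, and the prior of `β` has the density
`exp (-(β - b)ᵀ W (β - b) / (2 s))` up to a factor that depends on `s` only, with `W = V⁻¹` for the
informative prior and `W = 0` for the flat one. Completing the square around the generalized ridge
estimator writes the product of likelihood and prior as a Gaussian density in `β` times a constant
multiple of a power of `1 / s` and `exp (-Q / (2 s))`, where `Q` is the minimum of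
`(z - F β)ᵀ R⁻¹ (z - F β) + (β - b)ᵀ W (β - b)`. The first factor is the posterior of `β` given `s`;
the second one is the marginal likelihood of `s`, and multiplied by the prior of `s` it is an
inverse-gamma kernel. The formulas for `Q` in terms of the generalized least squares estimator come
from the normal equations.

For proper priors the conditional distributions are identified from a conditional density of the
observations given the parameters, through the Bayes formula for disintegrations. The second level
is conditioned on `z₁` throughout: since `Z₂ = ρ Z₁ + δ` with `δ` independent of `Z₁` given the
parameters, `z₂` follows a regression model whose design `[z₁(D₂) F₂]` depends on `z₁`.
-/

noncomputable section

namespace CoKriging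

section Disintegration

variable {Ω 𝓧 𝓨 𝓩 𝓦 𝓑 : Type*} [MeasurableSpace Ω] [MeasurableSpace 𝓧] [MeasurableSpace 𝓨]
  [MeasurableSpace 𝓩] [MeasurableSpace 𝓦] [MeasurableSpace 𝓑]

lemma lintegral_withDensity_mul (μ : Measure 𝓧) {g f : 𝓧 → ℝ≥0∞}
    (hg : Measurable g) (hf : Measurable f) :
    ∫⁻ x, f x ∂μ.withDensity g = ∫⁻ x, g x * f x ∂μ := by
  simpa using lintegral_withDensity_eq_lintegral_mul μ hg hf

lemma map_snd_withDensity_prod {μ : Measure 𝓧} {ν : Measure 𝓨} [SFinite μ] [SFinite ν]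
    {h : 𝓧 × 𝓨 → ℝ≥0∞} (hh : Measurable h) :
    ((μ.prod ν).withDensity h).map Prod.snd = ν.withDensity fun y => ∫⁻ x, h (x, y) ∂μ := by
  refine Measure.ext_of_lintegral _ fun f hf => ?_
  rw [lintegral_map hf measurable_snd, lintegral_withDensity_mul _ hh (by fun_prop),
    lintegral_prod_symm' _ (by fun_prop),
    lintegral_withDensity_mul _ hh.lintegral_prod_left' hf]
  exact lintegral_congr fun y => lintegral_mul_const (f y) (hh.comp measurable_prodMk_right)

lemma map_fst_withDensity_compProd {μ : Measure 𝓨} {κ : Kernel 𝓨 𝓑} [SFinite μ]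
    [IsSFiniteKernel κ] {h : 𝓨 × 𝓑 → ℝ≥0∞} (hh : Measurable h) :
    ((μ ⊗ₘ κ).withDensity h).map Prod.fst = μ.withDensity fun y => ∫⁻ b, h (y, b) ∂κ y := by
  refine Measure.ext_of_lintegral _ fun f hf => ?_
  rw [lintegral_map hf measurable_fst, lintegral_withDensity_mul _ hh (by fun_prop),
    Measure.lintegral_compProd (by fun_prop),
    lintegral_withDensity_mul _ hh.lintegral_kernel_prod_right' hf]
  exact lintegral_congr fun y => lintegral_mul_const (f y) (hh.comp measurable_prodMk_left)

lemma map_add_withDensity_prod [AddCommGroup 𝓩] [MeasurableAdd₂ 𝓩] [MeasurableSub₂ 𝓩]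
    {μ : Measure 𝓨} {ν : Measure 𝓩} [SFinite μ] [SFinite ν] [ν.IsAddLeftInvariant] {c : 𝓨 → 𝓩}
    (hc : Measurable c) {h : 𝓨 × 𝓩 → ℝ≥0∞} (hh : Measurable h) :
    ((μ.prod ν).withDensity h).map (fun q => (q.1, c q.1 + q.2)) =
      (μ.prod ν).withDensity fun q => h (q.1, q.2 - c q.1) := by
  have hmp : MeasurePreserving (fun q : 𝓨 × 𝓩 => (q.1, c q.1 + q.2)) (μ.prod ν) (μ.prod ν) :=
    (MeasurePreserving.id μ).skew_product (by fun_prop)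
      (Filter.Eventually.of_forall fun y => (measurePreserving_add_left ν (c y)).map_eq)
  have hm : Measurable fun q : 𝓨 × 𝓩 => h (q.1, q.2 - c q.1) := by fun_prop
  refine Measure.ext_of_lintegral _ fun f hf => ?_
  rw [lintegral_map hf hmp.measurable, lintegral_withDensity_mul _ hh (by fun_prop),
    lintegral_withDensity_mul _ hm hf, ← hmp.lintegral_comp (hm.fun_mul hf)]
  simp only [add_sub_cancel_left]

lemma ae_map_prodMk_of_ae_map_fst {P : Measure Ω} {X : Ω → 𝓧} {Y : Ω → 𝓨} (hY : Measurable Y)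
    {p : 𝓧 → Prop} (hp : ∀ᵐ x ∂P.map X, p x) : ∀ᵐ y ∂P.map (fun ω => (X ω, Y ω)), p y.1 := by
  rw [← Measure.fst_map_prodMk hY, Measure.fst] at hp
  exact ae_of_ae_map measurable_fst.aemeasurable hp

lemma lintegral_smul_inv_smul_withDensity (μ : Measure 𝓧) {h : 𝓧 → ℝ≥0∞} (hh : Measurable h)
    (hfin : ∫⁻ x, h x ∂μ ≠ ⊤) :
    (∫⁻ x, h x ∂μ) • (∫⁻ x, h x ∂μ)⁻¹ • μ.withDensity h = μ.withDensity h := by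
  by_cases h0 : ∫⁻ x, h x ∂μ = 0
  · rw [withDensity_congr_ae ((lintegral_eq_zero_iff hh).1 h0), withDensity_zero, smul_zero,
      smul_zero]
  · rw [smul_smul, ENNReal.mul_inv_cancel h0 hfin, one_smul]

section CondDistrib

variable [StandardBorelSpace 𝓑] [Nonempty 𝓑] {P : Measure Ω} [IsFiniteMeasure P]
  {Y : Ω → 𝓨} {B : Ω → 𝓑}

lemma lintegral_of_condDistrib_ae_eq (hY : Measurable Y) (hB : Measurable B)
    {κ : 𝓨 → Measure 𝓑} (hκ : condDistrib B Y P =ᵐ[P.map Y] κ)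
    {f : 𝓨 × 𝓑 → ℝ≥0∞} (hf : Measurable f) :
    ∫⁻ ω, f (Y ω, B ω) ∂P = ∫⁻ y, ∫⁻ b, f (y, b) ∂κ y ∂P.map Y := by
  rw [← lintegral_map hf (hY.prodMk hB), ← compProd_map_condDistrib hB.aemeasurable,
    Measure.lintegral_compProd hf]
  refine lintegral_congr_ae ?_
  filter_upwards [hκ] with y hy
  rw [hy]

theorem condDistrib_ae_eq_of_map_eq_withDensity (hB : Measurable B)
    {μ : Measure 𝓨} [SFinite μ] {κ : Kernel 𝓨 𝓑} [IsSFiniteKernel κ] {h : 𝓨 × 𝓑 → ℝ≥0∞}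
    (hh : Measurable h) (hjoint : P.map (fun ω => (Y ω, B ω)) = (μ ⊗ₘ κ).withDensity h) :
    ∀ᵐ y ∂P.map Y, condDistrib B Y P y =
      (∫⁻ b, h (y, b) ∂κ y)⁻¹ • (κ y).withDensity fun b => h (y, b) := by
  set I : 𝓨 → ℝ≥0∞ := fun y => ∫⁻ b, h (y, b) ∂κ y
  have hIm : Measurable I := hh.lintegral_kernel_prod_right'
  have hmap : P.map Y = μ.withDensity I := by
    rw [← Measure.fst_map_prodMk hB, Measure.fst, hjoint, map_fst_withDensity_compProd hh]
  have hfin : ∀ᵐ y ∂μ, I y < ⊤ := by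
    refine ae_lt_top hIm ?_
    rw [← setLIntegral_univ, ← withDensity_apply _ MeasurableSet.univ, ← hmap]
    exact measure_ne_top _ _
  have hg : Measurable (Function.uncurry fun y b => (I y)⁻¹ * h (y, b)) := by
    unfold Function.uncurry
    fun_prop
  set posterior : Kernel 𝓨 𝓑 := κ.withDensity fun y b => (I y)⁻¹ * h (y, b) with hpost
  have hposterior (y : 𝓨) : posterior y = (I y)⁻¹ • (κ y).withDensity fun b => h (y, b) := by
    rw [hpost, Kernel.withDensity_apply _ hg]
    exact withDensity_smul _ (by fun_prop)
  have : IsFiniteKernel posterior := by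
    refine ⟨1, ENNReal.one_lt_top, fun y => ?_⟩
    rw [hposterior, Measure.smul_apply, withDensity_apply _ MeasurableSet.univ,
      Measure.restrict_univ]
    exact ENNReal.inv_mul_le_one _
  suffices hcompProd : P.map (fun ω => (Y ω, B ω)) = P.map Y ⊗ₘ posterior by
    filter_upwards [condDistrib_ae_eq_of_measure_eq_compProd Y hB.aemeasurable hcompProd]
      with y hy
    rw [hy, hposterior]
  refine Measure.ext_of_lintegral _ fun f hf => ?_
  rw [hjoint, lintegral_withDensity_mul _ hh hf, Measure.lintegral_compProd (by fun_prop),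
    Measure.lintegral_compProd hf, hmap,
    lintegral_withDensity_mul _ hIm hf.lintegral_kernel_prod_right']
  refine lintegral_congr_ae ?_
  filter_upwards [hfin] with y hy
  have hhy : Measurable fun b => h (y, b) := by fun_prop
  have hfy : Measurable fun b => f (y, b) := by fun_prop
  rw [← lintegral_withDensity_mul _ hhy hfy, ← lintegral_smul_inv_smul_withDensity _ hhy hy.ne,
    ← hposterior, lintegral_smul_measure, smul_eq_mul]

lemma condDistrib_comp_leftInverse {e : 𝓨 → 𝓩} {g : 𝓩 → 𝓨} (he : Measurable e)
    (hg : Measurable g) (hge : Function.LeftInverse g e) (hY : Measurable Y) (hB : Measurable B) :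
    ∀ᵐ y ∂P.map Y, condDistrib B Y P y = condDistrib B (fun ω => e (Y ω)) P (e y) := by
  suffices h : condDistrib B Y P =ᵐ[P.map Y] (condDistrib B (fun ω => e (Y ω)) P).comap e he from h
  refine condDistrib_ae_eq_of_measure_eq_compProd Y hB.aemeasurable ?_
  refine Measure.ext_of_lintegral _ fun f hf => ?_
  have hm : Measurable fun z => ∫⁻ b, f (g z, b) ∂condDistrib B (fun ω => e (Y ω)) P z :=
    Measurable.lintegral_kernel_prod_right' (f := fun q : 𝓩 × 𝓑 => f (g q.1, q.2)) (by fun_prop)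
  calc ∫⁻ q, f q ∂P.map (fun ω => (Y ω, B ω))
      = ∫⁻ ω, f (g (e (Y ω)), B ω) ∂P := by
        simp only [lintegral_map hf (hY.prodMk hB), hge (Y _)]
    _ = ∫⁻ z, ∫⁻ b, f (g z, b) ∂condDistrib B (fun ω => e (Y ω)) P z ∂P.map (fun ω => e (Y ω)) :=
        lintegral_of_condDistrib_ae_eq (f := fun q : 𝓩 × 𝓑 => f (g q.1, q.2)) (he.comp hY) hB
          (Filter.EventuallyEq.refl _ _) (by fun_prop)
    _ = ∫⁻ q, f q ∂(P.map Y ⊗ₘ (condDistrib B (fun ω => e (Y ω)) P).comap e he) := by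
        rw [lintegral_map hm (by fun_prop), Measure.lintegral_compProd hf,
          lintegral_map hf.lintegral_kernel_prod_right' hY]
        simp only [hge (Y _), Kernel.comap_apply]

lemma condDistrib_ae_eq_of_comp_leftInverse {e : 𝓨 → 𝓩} {g : 𝓩 → 𝓨} (he : Measurable e)
    (hg : Measurable g) (hge : Function.LeftInverse g e) (hY : Measurable Y) (hB : Measurable B)
    {κ : 𝓩 → Measure 𝓑}
    (h : ∀ᵐ z ∂P.map (fun ω => e (Y ω)), condDistrib B (fun ω => e (Y ω)) P z = κ z) :
    ∀ᵐ y ∂P.map Y, condDistrib B Y P y = κ (e y) := by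
  have hmap : (P.map Y).map e = P.map fun ω => e (Y ω) := Measure.map_map he hY
  rw [← hmap] at h
  filter_upwards [condDistrib_comp_leftInverse he hg hge hY hB, ae_of_ae_map he.aemeasurable h]
    with y hcomp hκ
  rw [hcomp, hκ]

end CondDistrib

end Disintegration

section CondDensity

variable {Ω 𝓤 𝓧 𝓩 𝓦 𝓑 : Type*} [MeasurableSpace Ω] [MeasurableSpace 𝓤] [MeasurableSpace 𝓧]
  [MeasurableSpace 𝓩] [MeasurableSpace 𝓦] [MeasurableSpace 𝓑]

/-- Given `X`, the random variable `Z` has the conditional density `L x` with respect to `ρ`;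
encoded as a formula for the joint law of `X` and `Z`. -/
structure HasCondDensity (P : Measure Ω) (Z : Ω → 𝓩) (X : Ω → 𝓧) (ρ : Measure 𝓩)
    (L : 𝓧 → 𝓩 → ℝ) : Prop where
  measurable_left : Measurable Z
  measurable_right : Measurable X
  measurable_density : Measurable fun q : 𝓧 × 𝓩 => L q.1 q.2
  map_eq : P.map (fun ω => (X ω, Z ω)) =
    ((P.map X).prod ρ).withDensity fun q => ENNReal.ofReal (L q.1 q.2)

variable {P : Measure Ω} {U : Ω → 𝓤} {X : Ω → 𝓧} {Z : Ω → 𝓩} {W : Ω → 𝓦}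
  {B : Ω → 𝓑} {ρ : Measure 𝓩} [SFinite ρ] {τ : Measure 𝓦} [SFinite τ]

lemma hasCondDensity_iff_lintegral (hZ : Measurable Z) (hX : Measurable X) {L : 𝓧 → 𝓩 → ℝ}
    (hL : Measurable fun q : 𝓧 × 𝓩 => L q.1 q.2) :
    HasCondDensity P Z X ρ L ↔ ∀ f : 𝓧 × 𝓩 → ℝ≥0∞, Measurable f →
      ∫⁻ ω, f (X ω, Z ω) ∂P = ∫⁻ x, ∫⁻ z, ENNReal.ofReal (L x z) * f (x, z) ∂ρ ∂P.map X := by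
  have hjoint (f : 𝓧 × 𝓩 → ℝ≥0∞) (hf : Measurable f) :
      ∫⁻ q, f q ∂((P.map X).prod ρ).withDensity (fun q => ENNReal.ofReal (L q.1 q.2)) =
        ∫⁻ x, ∫⁻ z, ENNReal.ofReal (L x z) * f (x, z) ∂ρ ∂P.map X := by
    rw [lintegral_withDensity_mul _ hL.ennreal_ofReal hf, lintegral_prod _ (by fun_prop)]
  refine ⟨fun h f hf => ?_, fun h => ⟨hZ, hX, hL, Measure.ext_of_lintegral _ fun f hf => ?_⟩⟩
  · rw [← lintegral_map hf (hX.prodMk hZ), h.map_eq, hjoint f hf]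
  · rw [lintegral_map hf (hX.prodMk hZ), h f hf, hjoint f hf]

namespace HasCondDensity

lemma lintegral_eq {L : 𝓧 → 𝓩 → ℝ} (h : HasCondDensity P Z X ρ L) {f : 𝓧 × 𝓩 → ℝ≥0∞}
    (hf : Measurable f) :
    ∫⁻ ω, f (X ω, Z ω) ∂P = ∫⁻ x, ∫⁻ z, ENNReal.ofReal (L x z) * f (x, z) ∂ρ ∂P.map X :=
  (hasCondDensity_iff_lintegral h.measurable_left h.measurable_right h.measurable_density).1 h f hf

theorem of_condDistrib [IsFiniteMeasure P] [StandardBorelSpace 𝓩] [Nonempty 𝓩] (hZ : Measurable Z)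
    (hX : Measurable X) {L : 𝓧 → 𝓩 → ℝ} (hL : Measurable fun q : 𝓧 × 𝓩 => L q.1 q.2)
    (h : condDistrib Z X P =ᵐ[P.map X] fun x => ρ.withDensity fun z => ENNReal.ofReal (L x z)) :
    HasCondDensity P Z X ρ L := by
  refine (hasCondDensity_iff_lintegral hZ hX hL).2 fun f hf => ?_
  rw [lintegral_of_condDistrib_ae_eq hX hZ h hf]
  exact lintegral_congr fun x => lintegral_withDensity_mul _
    (hL.comp measurable_prodMk_left).ennreal_ofReal (hf.comp measurable_prodMk_left)

theorem comp_right {g : 𝓤 → 𝓧} (hg : Measurable g) {L : 𝓧 → 𝓩 → ℝ}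
    (hL : Measurable fun q : 𝓧 × 𝓩 => L q.1 q.2)
    (h : HasCondDensity P Z U ρ fun u => L (g u)) :
    HasCondDensity P Z (fun ω => g (U ω)) ρ L := by
  have hU := h.measurable_right
  refine (hasCondDensity_iff_lintegral h.measurable_left (hg.comp hU) hL).2 fun f hf => ?_
  have hm : Measurable fun x => ∫⁻ z, ENNReal.ofReal (L x z) * f (x, z) ∂ρ :=
    (hL.ennreal_ofReal.mul hf).lintegral_prod_right'
  calc ∫⁻ ω, f (g (U ω), Z ω) ∂P
      = ∫⁻ u, ∫⁻ z, ENNReal.ofReal (L (g u) z) * f (g u, z) ∂ρ ∂P.map U :=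
        h.lintegral_eq (f := fun q => f (g q.1, q.2)) (by fun_prop)
    _ = ∫⁻ x, ∫⁻ z, ENNReal.ofReal (L x z) * f (x, z) ∂ρ ∂P.map fun ω => g (U ω) := by
        rw [lintegral_map (by fun_prop) hU, lintegral_map hm (by fun_prop)]

theorem add_left [SFinite P] [AddCommGroup 𝓩] [MeasurableAdd₂ 𝓩] [MeasurableSub₂ 𝓩]
    [ρ.IsAddLeftInvariant] {c : 𝓧 → 𝓩} (hc : Measurable c) {L : 𝓧 → 𝓩 → ℝ}
    (h : HasCondDensity P Z X ρ L) :
    HasCondDensity P (fun ω => c (X ω) + Z ω) X ρ fun x z => L x (z - c x) := by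
  have hZ := h.measurable_left
  have hX := h.measurable_right
  have hL := h.measurable_density
  refine ⟨by fun_prop, hX, hL.comp (f := fun q : 𝓧 × 𝓩 => (q.1, q.2 - c q.1)) (by fun_prop), ?_⟩
  rw [← map_add_withDensity_prod hc hL.ennreal_ofReal, ← h.map_eq,
    Measure.map_map (by fun_prop) (hX.prodMk hZ)]
  rfl

section Product

variable [IsFiniteMeasure P] [StandardBorelSpace 𝓩] [Nonempty 𝓩] [StandardBorelSpace 𝓦] [Nonempty 𝓦]
  {μ : 𝓧 → Measure 𝓩} {ν : 𝓧 → Measure 𝓦} [∀ x, IsProbabilityMeasure (ν x)]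

theorem fst_of_condDistrib_eq_prod (hZ : Measurable Z) (hW : Measurable W) (hX : Measurable X)
    (h : condDistrib (fun ω => (Z ω, W ω)) X P =ᵐ[P.map X] fun x => (μ x).prod (ν x))
    {L : 𝓧 → 𝓩 → ℝ} (hL : Measurable fun q : 𝓧 × 𝓩 => L q.1 q.2)
    (hμ : ∀ᵐ x ∂P.map X, μ x = ρ.withDensity fun z => ENNReal.ofReal (L x z)) :
    HasCondDensity P Z X ρ L := by
  refine of_condDistrib hZ hX hL ?_
  filter_upwards [condDistrib_comp X (hZ.prodMk hW).aemeasurable measurable_fst, h, hμ]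
    with x hcomp hprod hx
  rw [← hx, ← Measure.fst_prod (μ := μ x) (ν := ν x), Measure.fst, ← hprod,
    ← Kernel.map_apply _ measurable_fst]
  exact hcomp

theorem snd_of_condDistrib_eq_prod [∀ x, SFinite (μ x)] (hZ : Measurable Z) (hW : Measurable W)
    (hX : Measurable X)
    (h : condDistrib (fun ω => (Z ω, W ω)) X P =ᵐ[P.map X] fun x => (μ x).prod (ν x))
    {L : 𝓧 → 𝓦 → ℝ} (hL : Measurable fun q : 𝓧 × 𝓦 => L q.1 q.2)
    (hν : ∀ᵐ x ∂P.map X, ν x = τ.withDensity fun w => ENNReal.ofReal (L x w)) :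
    HasCondDensity P W (fun ω => (X ω, Z ω)) τ fun y => L y.1 := by
  have hL' : Measurable fun q : (𝓧 × 𝓩) × 𝓦 => L q.1.1 q.2 := by fun_prop
  refine (hasCondDensity_iff_lintegral hW (hX.prodMk hZ) hL').2 fun f hf => ?_
  have hm : Measurable fun y : 𝓧 × 𝓩 => ∫⁻ w, ENNReal.ofReal (L y.1 w) * f (y, w) ∂τ :=
    (hL'.ennreal_ofReal.mul hf).lintegral_prod_right'
  rw [lintegral_map hm (hX.prodMk hZ),
    lintegral_of_condDistrib_ae_eq hX (hZ.prodMk hW) h (f := fun q => f ((q.1, q.2.1), q.2.2))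
      (by fun_prop),
    lintegral_of_condDistrib_ae_eq hX (hZ.prodMk hW) h
      (f := fun q => ∫⁻ w, ENNReal.ofReal (L q.1 w) * f ((q.1, q.2.1), w) ∂τ)
      (hm.comp (f := fun q : 𝓧 × 𝓩 × 𝓦 => (q.1, q.2.1)) (by fun_prop))]
  refine lintegral_congr_ae ?_
  filter_upwards [hν] with x hx
  have hmx : Measurable fun q : 𝓩 × 𝓦 => ∫⁻ w, ENNReal.ofReal (L x w) * f ((x, q.1), w) ∂τ :=
    hm.comp (f := fun q : 𝓩 × 𝓦 => (x, q.1)) (by fun_prop)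
  rw [lintegral_prod _ (by fun_prop), lintegral_prod _ hmx.aemeasurable]
  refine lintegral_congr fun z => ?_
  simp only [lintegral_const, measure_univ, mul_one]
  rw [hx]
  exact lintegral_withDensity_mul _ (hL.comp measurable_prodMk_left).ennreal_ofReal
    (hf.comp measurable_prodMk_left)

end Product

section Prior

variable [IsFiniteMeasure P] [StandardBorelSpace 𝓑] [Nonempty 𝓑]

theorem of_evidence_eq {L : 𝓧 × 𝓑 → 𝓩 → ℝ} {M : 𝓧 → 𝓩 → ℝ}
    (h : HasCondDensity P Z (fun ω => (X ω, B ω)) ρ L)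
    (hM : Measurable fun q : 𝓧 × 𝓩 => M q.1 q.2)
    (hLM : ∀ᵐ x ∂P.map X, ∀ z,
      evidence (condDistrib B X P x) (fun b => L (x, b) z) = ENNReal.ofReal (M x z)) :
    HasCondDensity P Z X ρ M := by
  have hX : Measurable X := h.measurable_right.fst
  have hB : Measurable B := h.measurable_right.snd
  have hL := h.measurable_density
  refine (hasCondDensity_iff_lintegral h.measurable_left hX hM).2 fun f hf => ?_
  have hm : Measurable fun y => ∫⁻ z, ENNReal.ofReal (L y z) * f (y.1, z) ∂ρ :=
    Measurable.lintegral_prod_right' (f := fun q : (𝓧 × 𝓑) × 𝓩 =>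
      ENNReal.ofReal (L q.1 q.2) * f (q.1.1, q.2)) (by fun_prop)
  rw [h.lintegral_eq (f := fun q => f (q.1.1, q.2)) (by fun_prop),
    lintegral_map hm (hX.prodMk hB),
    lintegral_of_condDistrib_ae_eq hX hB (Filter.EventuallyEq.refl _ _) hm]
  refine lintegral_congr_ae ?_
  filter_upwards [hLM] with x hx
  rw [lintegral_lintegral_swap (by fun_prop)]
  refine lintegral_congr fun z => ?_
  rw [← hx z]
  exact lintegral_mul_const _ (hL.comp (f := fun b => ((x, b), z)) (by fun_prop)).ennreal_ofReal

theorem condDistrib_ae_eq_bayes {L : 𝓧 × 𝓑 → 𝓩 → ℝ}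
    (h : HasCondDensity P Z (fun ω => (X ω, B ω)) ρ L) :
    ∀ᵐ y ∂P.map (fun ω => (X ω, Z ω)), condDistrib B (fun ω => (X ω, Z ω)) P y =
      bayes (condDistrib B X P y.1) fun b => L (y.1, b) y.2 := by
  have hX : Measurable X := h.measurable_right.fst
  have hB : Measurable B := h.measurable_right.snd
  have hZ := h.measurable_left
  have hL := h.measurable_density
  have hL' : Measurable fun q : (𝓧 × 𝓩) × 𝓑 => ENNReal.ofReal (L (q.1.1, q.2) q.1.2) := by
    fun_prop
  suffices hjoint : P.map (fun ω => ((X ω, Z ω), B ω)) =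
      (((P.map X).prod ρ) ⊗ₘ (condDistrib B X P).prodMkRight 𝓩).withDensity
        fun q => ENNReal.ofReal (L (q.1.1, q.2) q.1.2) by
    simpa only [bayes, evidence, Kernel.prodMkRight_apply] using
      condDistrib_ae_eq_of_map_eq_withDensity hB hL' hjoint
  refine Measure.ext_of_lintegral _ fun f hf => ?_
  have hm : Measurable fun y : 𝓧 × 𝓑 => ∫⁻ z, ENNReal.ofReal (L y z) * f ((y.1, z), y.2) ∂ρ :=
    Measurable.lintegral_prod_right' (f := fun q : (𝓧 × 𝓑) × 𝓩 =>
      ENNReal.ofReal (L q.1 q.2) * f ((q.1.1, q.2), q.1.2)) (by fun_prop)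
  calc ∫⁻ q, f q ∂P.map (fun ω => ((X ω, Z ω), B ω))
      = ∫⁻ y, ∫⁻ z, ENNReal.ofReal (L y z) * f ((y.1, z), y.2) ∂ρ ∂P.map fun ω => (X ω, B ω) := by
        rw [lintegral_map hf ((hX.prodMk hZ).prodMk hB),
          h.lintegral_eq (f := fun q => f ((q.1.1, q.2), q.1.2)) (by fun_prop)]
    _ = ∫⁻ x, ∫⁻ z, ∫⁻ b, ENNReal.ofReal (L (x, b) z) * f ((x, z), b) ∂condDistrib B X P x ∂ρ
          ∂P.map X := by
        rw [lintegral_map hm (hX.prodMk hB),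
          lintegral_of_condDistrib_ae_eq hX hB (Filter.EventuallyEq.refl _ _) hm]
        refine lintegral_congr fun x => ?_
        rw [lintegral_lintegral_swap (by fun_prop)]
    _ = _ := by
        rw [lintegral_withDensity_mul _ hL' hf, Measure.lintegral_compProd (by fun_prop),
          lintegral_prod _ (hL'.fun_mul hf).lintegral_kernel_prod_right'.aemeasurable]
        simp only [Kernel.prodMkRight_apply]

theorem condDistrib_ae_eq_bayes_map {L : 𝓑 → 𝓩 → ℝ} (h : HasCondDensity P Z B ρ L) :
    ∀ᵐ z ∂P.map Z, condDistrib B Z P z = bayes (P.map B) fun b => L b z := by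
  have hB := h.measurable_right
  have hZ := h.measurable_left
  have hL := h.measurable_density
  have hL' : Measurable fun q : 𝓩 × 𝓑 => ENNReal.ofReal (L q.2 q.1) := by fun_prop
  suffices hjoint : P.map (fun ω => (Z ω, B ω)) =
      (ρ ⊗ₘ Kernel.const 𝓩 (P.map B)).withDensity fun q => ENNReal.ofReal (L q.2 q.1) by
    simpa only [bayes, evidence, Kernel.const_apply] using
      condDistrib_ae_eq_of_map_eq_withDensity hB hL' hjoint
  refine Measure.ext_of_lintegral _ fun f hf => ?_
  rw [lintegral_map hf (hZ.prodMk hB), h.lintegral_eq (f := fun q => f (q.2, q.1)) (by fun_prop),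
    lintegral_withDensity_mul _ hL' hf, Measure.compProd_const, lintegral_prod _ (by fun_prop)]
  rw [lintegral_lintegral_swap (by fun_prop)]

end Prior

end HasCondDensity

lemma bayes_eq_of_withDensity_eq_smul {prior K : Measure 𝓑} [IsProbabilityMeasure K]
    {L : 𝓑 → ℝ} {c : ℝ} (hc : 0 < c)
    (h : prior.withDensity (fun b => ENNReal.ofReal (L b)) = ENNReal.ofReal c • K) :
    evidence prior L = ENNReal.ofReal c ∧ bayes prior L = K := by
  have hev : evidence prior L = ENNReal.ofReal c := by
    rw [evidence, ← setLIntegral_univ, ← withDensity_apply _ MeasurableSet.univ, h]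
    simp
  refine ⟨hev, ?_⟩
  rw [bayes, hev, h, smul_smul, ENNReal.inv_mul_cancel (ENNReal.ofReal_pos.2 hc).ne'
    ENNReal.ofReal_ne_top, one_smul]

theorem bayes_prod_map_snd {μ : Measure 𝓧} {ν : Measure 𝓑} [SFinite μ] [SFinite ν] {L : 𝓧 × 𝓑 → ℝ}
    (hL : Measurable L) {M : 𝓑 → ℝ}
    (h : ∀ᵐ y ∂ν, evidence μ (fun x => L (x, y)) = ENNReal.ofReal (M y)) :
    evidence (μ.prod ν) L = evidence ν M ∧
      (bayes (μ.prod ν) L).map Prod.snd = bayes ν M := by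
  have hevidence : evidence (μ.prod ν) L = evidence ν M := by
    rw [evidence, lintegral_prod_symm' _ hL.ennreal_ofReal]
    exact lintegral_congr_ae h
  refine ⟨hevidence, ?_⟩
  rw [bayes, bayes, hevidence, Measure.map_smul, map_snd_withDensity_prod hL.ennreal_ofReal]
  exact congrArg _ (withDensity_congr_ae h)

end CondDensity

section GaussianDensity

variable {ι : Type*} [Fintype ι]

lemma pi_gaussianReal_eq_withDensity :
    Measure.pi (fun _ : ι => gaussianReal 0 1) =
      volume.withDensity fun x : ι → ℝ => ENNReal.ofReal (∏ i, gaussianPDFReal 0 1 (x i)) := by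
  refine Measure.pi_eq fun s hs => ?_
  rw [withDensity_apply _ (MeasurableSet.univ_pi hs), volume_pi, Measure.restrict_pi_pi,
    ← ofReal_integral_eq_lintegral_ofReal, integral_fintype_prod_eq_prod,
    ENNReal.ofReal_prod_of_nonneg]
  · exact Finset.prod_congr rfl fun i _ => (gaussianReal_apply_eq_integral 0 one_ne_zero (s i)).symm
  · exact fun i _ => integral_nonneg fun x => gaussianPDFReal_nonneg _ _ _
  · exact Integrable.fintype_prod fun i => (integrable_gaussianPDFReal 0 1).restrict
  · exact Filter.Eventually.of_forall fun x =>
      Finset.prod_nonneg fun i _ => gaussianPDFReal_nonneg _ _ _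

variable [DecidableEq ι]

lemma gaussDensity_nonneg (m : EuclideanSpace ℝ ι) (S : Matrix ι ι ℝ) (z : EuclideanSpace ℝ ι) :
    0 ≤ gaussDensity m S z := by
  unfold gaussDensity
  positivity

lemma measurable_gaussDensity (m : EuclideanSpace ℝ ι) (S : Matrix ι ι ℝ) :
    Measurable (gaussDensity m S) := by
  unfold gaussDensity quad
  simp only [dotProduct, mulVec]
  fun_prop

lemma gaussDensity_zero_one (x : EuclideanSpace ℝ ι) :
    gaussDensity 0 1 x =
      (Real.sqrt ((2 * Real.pi) ^ Fintype.card ι))⁻¹ * Real.exp (-(1 / 2) * ‖x‖ ^ 2) := by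
  simp [gaussDensity, quad, EuclideanSpace.real_norm_sq_eq, dotProduct, ← sq]

lemma prod_gaussianPDFReal (x : EuclideanSpace ℝ ι) :
    ∏ i, gaussianPDFReal 0 1 (x i) = gaussDensity 0 1 x := by
  have hsqrt : Real.sqrt ((2 * Real.pi) ^ Fintype.card ι) =
      Real.sqrt (2 * Real.pi) ^ Fintype.card ι := by
    rw [Real.sqrt_eq_iff_mul_self_eq (by positivity) (by positivity), ← mul_pow,
      Real.mul_self_sqrt (by positivity)]
  simp only [gaussianPDFReal, Finset.prod_mul_distrib, ← Real.exp_sum, Finset.prod_const,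
    Finset.card_univ, gaussDensity_zero_one, EuclideanSpace.real_norm_sq_eq, Finset.mul_sum, hsqrt,
    inv_pow, NNReal.coe_one, mul_one, sub_zero]
  congr 2
  exact Finset.sum_congr rfl fun i _ => by ring

lemma stdGaussian_eq_withDensity :
    stdGaussian (EuclideanSpace ℝ ι) =
      volume.withDensity fun x => ENNReal.ofReal (gaussDensity 0 1 x) := by
  have hmp := PiLp.volume_preserving_toLp ι
  have hm := (measurable_gaussDensity (0 : EuclideanSpace ℝ ι) 1).ennreal_ofReal
  refine Measure.ext_of_lintegral _ fun f hf => ?_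
  rw [← map_pi_eq_stdGaussian, pi_gaussianReal_eq_withDensity, lintegral_map hf hmp.measurable,
    lintegral_withDensity_mul _ (by fun_prop) (by fun_prop), lintegral_withDensity_mul _ hm hf,
    ← hmp.lintegral_comp (hm.fun_mul hf)]
  simp only [← prod_gaussianPDFReal]

lemma lintegral_comp_add_toEuclideanCLM (m : EuclideanSpace ℝ ι) {T : Matrix ι ι ℝ}
    (hT : 0 < T.det) {f : EuclideanSpace ℝ ι → ℝ≥0∞} (hf : Measurable f) :
    ∫⁻ x, f (m + toEuclideanCLM (𝕜 := ℝ) T x) = ENNReal.ofReal T.det⁻¹ * ∫⁻ x, f x := by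
  have hdet : LinearMap.det (toEuclideanLin (𝕜 := ℝ) T) = T.det := by
    rw [Matrix.toEuclideanLin_eq_toLin_orthonormal, LinearMap.det_toLin]
  have hmap := Measure.map_linearMap_addHaar_eq_smul_addHaar
    (volume : Measure (EuclideanSpace ℝ ι)) (hdet ▸ hT.ne')
  rw [hdet, abs_of_pos (inv_pos.2 hT)] at hmap
  have hmeas : Measurable (toEuclideanLin (𝕜 := ℝ) T) :=
    (toEuclideanCLM (𝕜 := ℝ) T).continuous.measurable
  calc ∫⁻ x, f (m + toEuclideanCLM (𝕜 := ℝ) T x)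
      = ∫⁻ y, f (m + y) ∂(volume.map (toEuclideanLin (𝕜 := ℝ) T)) :=
        (lintegral_map (f := fun y => f (m + y)) (by fun_prop) hmeas).symm
    _ = ENNReal.ofReal T.det⁻¹ * ∫⁻ x, f x := by
        rw [hmap, lintegral_smul_measure, lintegral_add_left_eq_self, smul_eq_mul]

lemma quad_inv_mul_transpose {T : Matrix ι ι ℝ} (hT : 0 < T.det) (x : EuclideanSpace ℝ ι) :
    quad (T * Tᵀ)⁻¹ (toEuclideanCLM (𝕜 := ℝ) T x) = ‖x‖ ^ 2 := by
  have hunit : IsUnit T.det := hT.ne'.isUnit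
  rw [quad, ofLp_toEuclideanCLM, Matrix.mul_inv_rev, mulVec_mulVec, Matrix.mul_assoc,
    nonsing_inv_mul _ hunit, Matrix.mul_one, dotProduct_mulVec, ← mulVec_transpose,
    transpose_nonsing_inv, transpose_transpose, mulVec_mulVec, nonsing_inv_mul _ hunit, one_mulVec,
    EuclideanSpace.real_norm_sq_eq]
  simp only [dotProduct, sq]

lemma det_mul_gaussDensity_comp_add {T : Matrix ι ι ℝ} (hT : 0 < T.det)
    (m x : EuclideanSpace ℝ ι) :
    T.det * gaussDensity m (T * Tᵀ) (m + toEuclideanCLM (𝕜 := ℝ) T x) = gaussDensity 0 1 x := by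
  rw [gaussDensity, add_sub_cancel_left, quad_inv_mul_transpose hT, gaussDensity_zero_one, det_mul,
    det_transpose, Real.sqrt_mul (by positivity), Real.sqrt_mul_self hT.le]
  field_simp

lemma map_stdGaussian_eq_withDensity (m : EuclideanSpace ℝ ι) {T : Matrix ι ι ℝ}
    (hT : 0 < T.det) :
    (stdGaussian (EuclideanSpace ℝ ι)).map (fun x => m + toEuclideanCLM (𝕜 := ℝ) T x) =
      volume.withDensity fun x => ENNReal.ofReal (gaussDensity m (T * Tᵀ) x) := by
  have hm := (measurable_gaussDensity m (T * Tᵀ)).ennreal_ofReal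
  refine Measure.ext_of_lintegral _ fun f hf => ?_
  rw [lintegral_map hf (by fun_prop), stdGaussian_eq_withDensity,
    lintegral_withDensity_mul _ (measurable_gaussDensity 0 1).ennreal_ofReal (by fun_prop),
    lintegral_withDensity_mul _ hm hf]
  simp only [← det_mul_gaussDensity_comp_add hT m, ENNReal.ofReal_mul hT.le, mul_assoc]
  rw [lintegral_const_mul' _ _ ENNReal.ofReal_ne_top,
    lintegral_comp_add_toEuclideanCLM m hT (hm.fun_mul hf), ← mul_assoc,
    ← ENNReal.ofReal_mul hT.le, mul_inv_cancel₀ hT.ne', ENNReal.ofReal_one, one_mul]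

open scoped MatrixOrder in
theorem multivariateGaussian_eq_withDensity (m : EuclideanSpace ℝ ι) {S : Matrix ι ι ℝ}
    (hS : S.PosDef) :
    multivariateGaussian m S =
      volume.withDensity fun x => ENNReal.ofReal (gaussDensity m S x) := by
  have htranspose : (CFC.sqrt S)ᵀ = CFC.sqrt S := by
    simpa only [IsSelfAdjoint, star_eq_conjTranspose, conjTranspose_eq_transpose_of_trivial] using
      (CFC.sqrt_nonneg S).isSelfAdjoint
  have hdet : 0 < (CFC.sqrt S).det := by
    rw [hS.posSemidef.det_sqrt, RCLike.sqrt_of_nonneg hS.det_pos.le]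
    exact Real.sqrt_pos.2 hS.det_pos
  have hmap := map_stdGaussian_eq_withDensity m hdet
  rwa [htranspose, CFC.sqrt_mul_sqrt_self _ hS.posSemidef.nonneg] at hmap

lemma lintegral_gaussDensity (m : EuclideanSpace ℝ ι) {S : Matrix ι ι ℝ} (hS : S.PosDef) :
    ∫⁻ z, ENNReal.ofReal (gaussDensity m S z) = 1 := by
  rw [← setLIntegral_univ, ← withDensity_apply _ MeasurableSet.univ,
    ← multivariateGaussian_eq_withDensity m hS, measure_univ]

end GaussianDensity

section LeastSquares

lemma isSymm_of_posDef {ι : Type*} {M : Matrix ι ι ℝ} (hM : M.PosDef) : M.IsSymm :=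
  isHermitian_iff_isSymm.1 hM.isHermitian

variable {ι κ : Type*} [Fintype ι] [Fintype κ]

lemma quad_zero (v : EuclideanSpace ℝ ι) : quad 0 v = 0 := by
  simp [quad]

lemma quad_smul (c : ℝ) (M : Matrix ι ι ℝ) (v : EuclideanSpace ℝ ι) :
    quad (c • M) v = c * quad M v := by
  simp [quad, smul_mulVec]

lemma quad_add_vec {M : Matrix ι ι ℝ} (hM : M.IsSymm) (v w : EuclideanSpace ℝ ι) :
    quad M (v + w) = quad M v + 2 * (w.ofLp ⬝ᵥ M *ᵥ v.ofLp) + quad M w := by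
  have hcross : v.ofLp ⬝ᵥ M *ᵥ w.ofLp = w.ofLp ⬝ᵥ M *ᵥ v.ofLp := by
    rw [← dotProduct_transpose_mulVec, hM]
  simp only [quad, WithLp.ofLp_add, mulVec_add, add_dotProduct, dotProduct_add, hcross]
  ring

lemma quad_nonneg {M : Matrix ι ι ℝ} (hM : M.PosSemidef) (v : EuclideanSpace ℝ ι) :
    0 ≤ quad M v := by
  simpa [quad] using hM.dotProduct_mulVec_nonneg v.ofLp

lemma quad_pos {M : Matrix ι ι ℝ} (hM : M.PosDef) {v : EuclideanSpace ℝ ι} (hv : v ≠ 0) :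
    0 < quad M v := by
  simpa [quad] using hM.dotProduct_mulVec_pos (x := v.ofLp) (by simpa using hv)

lemma quad_neg (M : Matrix ι ι ℝ) (v : EuclideanSpace ℝ ι) : quad M (-v) = quad M v := by
  simp [quad, mulVec_neg]

lemma mulE_dotProduct (F : Matrix ι κ ℝ) (v : EuclideanSpace ℝ κ) (w : ι → ℝ) :
    (mulE F v).ofLp ⬝ᵥ w = v.ofLp ⬝ᵥ Fᵀ *ᵥ w := by
  rw [dotProduct_transpose_mulVec, dotProduct_comm, mulE]

lemma quad_mulE (F : Matrix ι κ ℝ) (S : Matrix ι ι ℝ) (v : EuclideanSpace ℝ κ) :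
    quad S (mulE F v) = quad (Fᵀ * S * F) v := by
  rw [quad, mulE_dotProduct]
  simp only [quad, mulE, mulVec_mulVec, Matrix.mul_assoc]

/-- Completing the square: `m` is the critical point of the left-hand side, as a function of
`β`. -/
theorem quad_sub_mulE_add_quad_sub {F : Matrix ι κ ℝ} {S : Matrix ι ι ℝ} {W : Matrix κ κ ℝ}
    (hS : S.IsSymm) (hW : W.IsSymm) {z : EuclideanSpace ℝ ι} {b m : EuclideanSpace ℝ κ}
    (hm : (Fᵀ * S * F + W) *ᵥ m.ofLp = (Fᵀ * S) *ᵥ z.ofLp + W *ᵥ b.ofLp)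
    (β : EuclideanSpace ℝ κ) :
    quad S (z - mulE F β) + quad W (β - b) =
      quad (Fᵀ * S * F + W) (β - m) + (quad S (z - mulE F m) + quad W (m - b)) := by
  have hgradient : Fᵀ *ᵥ S *ᵥ (z - mulE F m).ofLp = W *ᵥ (m - b).ofLp := by
    simp only [mulE, WithLp.ofLp_sub, mulVec_sub, mulVec_mulVec, ← Matrix.mul_assoc]
    rw [sub_eq_sub_iff_add_eq_add, ← hm, add_mulVec, add_comm]
  have hz : z - mulE F β = (z - mulE F m) + mulE F (m - β) := by
    simp only [mulE, WithLp.ofLp_sub, mulVec_sub, WithLp.toLp_sub]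
    abel
  have hb : β - b = (m - b) + -(m - β) := by abel
  rw [hz, hb, quad_add_vec hS, quad_add_vec hW, mulE_dotProduct, hgradient, quad_mulE, quad_neg,
    ← neg_sub m β, quad_neg, WithLp.ofLp_neg, neg_dotProduct]
  simp only [quad, add_mulVec, dotProduct_add]
  ring

lemma quad_sub_add_quad_inv_sub [DecidableEq κ] {M V : Matrix κ κ ℝ} (hM : M.PosDef)
    (hV : V.PosDef) {b g m : EuclideanSpace ℝ κ}
    (hm : (M + V⁻¹) *ᵥ m.ofLp = M *ᵥ g.ofLp + V⁻¹ *ᵥ b.ofLp) :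
    quad M (m - g) + quad V⁻¹ (m - b) = quad (V + M⁻¹)⁻¹ (b - g) := by
  have hMdet := hM.det_pos.ne'.isUnit
  have hVdet := hV.det_pos.ne'.isUnit
  have hKdet := (hV.add hM.inv).det_pos.ne'.isUnit
  set w := M *ᵥ (m - g).ofLp with hw
  -- Since `m` is critical, `w = M (m - g) = -V⁻¹ (m - b)`, so that `(V + M⁻¹) w = b - g`.
  have hVw : V⁻¹ *ᵥ (m - b).ofLp = -w := by
    rw [hw, WithLp.ofLp_sub, WithLp.ofLp_sub, mulVec_sub, mulVec_sub, neg_sub,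
      sub_eq_sub_iff_add_eq_add, ← hm, add_mulVec, add_comm]
  have hKw : (V + M⁻¹) *ᵥ w = (b - g).ofLp := by
    have hVb : V *ᵥ w = -(m - b).ofLp := by
      rw [← neg_neg w, ← hVw, mulVec_neg, mulVec_mulVec, mul_nonsing_inv _ hVdet, one_mulVec]
    rw [add_mulVec, hVb, hw, mulVec_mulVec, nonsing_inv_mul _ hMdet, one_mulVec]
    simp only [WithLp.ofLp_sub]
    abel
  have hw' : (V + M⁻¹)⁻¹ *ᵥ (b - g).ofLp = w := by
    rw [← hKw, mulVec_mulVec, nonsing_inv_mul _ hKdet, one_mulVec]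
  rw [quad, quad, quad, hVw, hw', ← hw, dotProduct_neg, ← sub_eq_add_neg, ← sub_dotProduct]
  congr 1
  simp only [WithLp.ofLp_sub]
  abel

end LeastSquares

section Ridge

lemma posDef_gram {ι κ : Type*} [Fintype ι] [DecidableEq ι] [Finite κ] {F : Matrix ι κ ℝ}
    {R : Matrix ι ι ℝ} (hR : R.PosDef) (hF : LinearIndependent ℝ F.col) :
    (Fᵀ * R⁻¹ * F).PosDef := by
  have := Fintype.ofFinite κ
  simpa only [conjTranspose_eq_transpose_of_trivial] using
    hR.inv.conjTranspose_mul_mul_same (mulVec_injective_iff.2 hF)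

variable {ι κ : Type*} [Fintype ι] [DecidableEq ι] [Fintype κ] [DecidableEq κ]

lemma posDef_gram_add_inv (F : Matrix ι κ ℝ) {R : Matrix ι ι ℝ} {V : Matrix κ κ ℝ}
    (hR : R.PosDef) (hV : V.PosDef) : (Fᵀ * R⁻¹ * F + V⁻¹).PosDef := by
  have hgram := hR.inv.posSemidef.conjTranspose_mul_mul_same F
  rw [conjTranspose_eq_transpose_of_trivial] at hgram
  exact Matrix.PosDef.posSemidef_add hgram hV.inv

/-- The generalized ridge estimator `(Fᵀ R⁻¹ F + W)⁻¹ (Fᵀ R⁻¹ z + W b)`, the minimizer of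
`(z - F β)ᵀ R⁻¹ (z - F β) + (β - b)ᵀ W (β - b)`. The informative posterior mean is the case
`W = V⁻¹`, the non-informative one the case `W = 0`. -/
def ridge (F : Matrix ι κ ℝ) (R : Matrix ι ι ℝ) (W : Matrix κ κ ℝ) (b : EuclideanSpace ℝ κ)
    (z : EuclideanSpace ℝ ι) : EuclideanSpace ℝ κ :=
  mulE (Fᵀ * R⁻¹ * F + W)⁻¹ (mulE (Fᵀ * R⁻¹) z + mulE W b)

/-- The minimum over `β` of `(z - F β)ᵀ R⁻¹ (z - F β) + (β - b)ᵀ W (β - b)`. -/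
def ridgeResidual (F : Matrix ι κ ℝ) (R : Matrix ι ι ℝ) (W : Matrix κ κ ℝ)
    (b : EuclideanSpace ℝ κ) (z : EuclideanSpace ℝ ι) : ℝ :=
  quad R⁻¹ (z - mulE F (ridge F R W b z)) + quad W (ridge F R W b z - b)

variable {F : Matrix ι κ ℝ} {R : Matrix ι ι ℝ} {W V : Matrix κ κ ℝ}

lemma gram_add_mulVec_ridge (hH : (Fᵀ * R⁻¹ * F + W).PosDef) (b : EuclideanSpace ℝ κ)
    (z : EuclideanSpace ℝ ι) :
    (Fᵀ * R⁻¹ * F + W) *ᵥ (ridge F R W b z).ofLp = (Fᵀ * R⁻¹) *ᵥ z.ofLp + W *ᵥ b.ofLp := by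
  simp only [ridge, mulE, WithLp.ofLp_add, mulVec_mulVec]
  rw [mul_nonsing_inv _ hH.det_pos.ne'.isUnit, one_mulVec]

lemma quad_sub_mulE_add_quad_sub_eq_ridge (hR : R.PosDef) (hW : W.IsSymm)
    (hH : (Fᵀ * R⁻¹ * F + W).PosDef) (b : EuclideanSpace ℝ κ) (z : EuclideanSpace ℝ ι)
    (β : EuclideanSpace ℝ κ) :
    quad R⁻¹ (z - mulE F β) + quad W (β - b) =
      quad (Fᵀ * R⁻¹ * F + W) (β - ridge F R W b z) + ridgeResidual F R W b z :=
  quad_sub_mulE_add_quad_sub (isSymm_of_posDef hR.inv) hW (gram_add_mulVec_ridge hH b z) β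

lemma ridge_zero (F : Matrix ι κ ℝ) (R : Matrix ι ι ℝ) (b : EuclideanSpace ℝ κ)
    (z : EuclideanSpace ℝ ι) : ridge F R 0 b z = gls F R z := by
  simp [ridge, gls, mulE, Matrix.mul_assoc]

lemma gram_mulVec_gls (hR : R.PosDef) (hF : LinearIndependent ℝ F.col)
    (z : EuclideanSpace ℝ ι) :
    (Fᵀ * R⁻¹ * F) *ᵥ (gls F R z).ofLp = (Fᵀ * R⁻¹) *ᵥ z.ofLp := by
  have hnormal := gram_add_mulVec_ridge (W := 0) (by simpa using posDef_gram hR hF) 0 z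
  simpa only [ridge_zero, add_zero, zero_mulVec] using hnormal

lemma scaleII_eq_quad_sub (hR : R.PosDef) (hF : LinearIndependent ℝ F.col)
    (z : EuclideanSpace ℝ ι) : scaleII F R z = quad R⁻¹ (z - mulE F (gls F R z)) := by
  have hresidual : R⁻¹ *ᵥ (z - mulE F (gls F R z)).ofLp =
      (R⁻¹ - R⁻¹ * F * (Fᵀ * R⁻¹ * F)⁻¹ * Fᵀ * R⁻¹) *ᵥ z.ofLp := by
    simp only [gls, mulE, WithLp.ofLp_sub, mulVec_sub, sub_mulVec, mulVec_mulVec, Matrix.mul_assoc]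
  have horthogonal : (mulE F (gls F R z)).ofLp ⬝ᵥ R⁻¹ *ᵥ (z - mulE F (gls F R z)).ofLp = 0 := by
    rw [mulE_dotProduct]
    simp only [mulE, WithLp.ofLp_sub, mulVec_sub, mulVec_mulVec, ← Matrix.mul_assoc,
      gram_mulVec_gls hR hF, sub_self, dotProduct_zero]
  rw [scaleII, quad, ← hresidual, ← sub_zero (z.ofLp ⬝ᵥ _), ← horthogonal, ← sub_dotProduct]
  rfl

lemma ridgeResidual_zero (hR : R.PosDef) (hF : LinearIndependent ℝ F.col)
    (b : EuclideanSpace ℝ κ) (z : EuclideanSpace ℝ ι) :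
    ridgeResidual F R 0 b z = scaleII F R z := by
  rw [ridgeResidual, ridge_zero, quad_zero, add_zero, scaleII_eq_quad_sub hR hF]

lemma scaleI_eq_two_mul_add_ridgeResidual (hR : R.PosDef) (hV : V.PosDef)
    (hF : LinearIndependent ℝ F.col) (b : EuclideanSpace ℝ κ) (γ : ℝ) (z : EuclideanSpace ℝ ι) :
    scaleI F R V b γ z = 2 * γ + ridgeResidual F R V⁻¹ b z := by
  have hM := posDef_gram hR hF
  have hfit : quad R⁻¹ (z - mulE F (ridge F R V⁻¹ b z)) =
      quad (Fᵀ * R⁻¹ * F) (ridge F R V⁻¹ b z - gls F R z) + scaleII F R z := by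
    have hgls := quad_sub_mulE_add_quad_sub_eq_ridge hR isSymm_zero (by simpa using hM) b z
      (ridge F R V⁻¹ b z)
    rwa [ridge_zero, ridgeResidual_zero hR hF, quad_zero, add_zero, add_zero] at hgls
  have hnormal := gram_add_mulVec_ridge (posDef_gram_add_inv F hR hV) b z
  rw [← gram_mulVec_gls hR hF] at hnormal
  rw [scaleI, ← quad_sub_add_quad_inv_sub hM hV hnormal, ridgeResidual, hfit]
  ring

lemma ridgeResidual_nonneg (hR : R.PosDef) (hW : W.PosSemidef) (b : EuclideanSpace ℝ κ)
    (z : EuclideanSpace ℝ ι) : 0 ≤ ridgeResidual F R W b z :=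
  add_nonneg (quad_nonneg hR.inv.posSemidef _) (quad_nonneg hW _)

lemma scaleII_pos (hR : R.PosDef) (hF : LinearIndependent ℝ F.col) {z : EuclideanSpace ℝ ι}
    (hz : z ∉ Set.range (mulE F)) : 0 < scaleII F R z := by
  rw [scaleII_eq_quad_sub hR hF]
  exact quad_pos hR.inv (sub_ne_zero.2 fun h => hz ⟨_, h.symm⟩)

end Ridge

section PosteriorParameters

variable {ι κ : Type*} [Fintype ι] [DecidableEq ι] [Fintype κ] [DecidableEq κ]
  {F : Matrix ι κ ℝ} {R : Matrix ι ι ℝ} {V : Matrix κ κ ℝ} {s : ℝ}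

lemma inv_smul_of_posDef {M : Matrix κ κ ℝ} (hM : M.PosDef) {c : ℝ} (hc : c ≠ 0) :
    (c • M)⁻¹ = c⁻¹ • M⁻¹ :=
  Matrix.inv_smul' M (Units.mk0 c hc) hM.det_pos.ne'.isUnit

lemma covI_eq_smul (F : Matrix ι κ ℝ) (hR : R.PosDef) (hV : V.PosDef) (hs : s ≠ 0) :
    covI F R V s = s • (Fᵀ * R⁻¹ * F + V⁻¹)⁻¹ := by
  rw [covI, Matrix.mul_smul, Matrix.smul_mul, ← smul_add,
    inv_smul_of_posDef (posDef_gram_add_inv F hR hV) (inv_ne_zero hs), inv_inv]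

lemma mulE_covI_nuI (F : Matrix ι κ ℝ) (hR : R.PosDef) (hV : V.PosDef) (hs : s ≠ 0)
    (b : EuclideanSpace ℝ κ) (z : EuclideanSpace ℝ ι) :
    mulE (covI F R V s) (nuI F R V b z s) = ridge F R V⁻¹ b z := by
  rw [covI_eq_smul F hR hV hs, nuI, ridge]
  simp only [mulE, Matrix.mul_smul, smul_mulVec, WithLp.ofLp_add, ← smul_add, mulVec_smul,
    smul_smul, inv_mul_cancel₀ hs, one_smul]

lemma covII_eq_smul (hR : R.PosDef) (hF : LinearIndependent ℝ F.col) (hs : s ≠ 0) :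
    covII F R s = s • (Fᵀ * R⁻¹ * F)⁻¹ := by
  rw [covII, Matrix.mul_smul, Matrix.smul_mul,
    inv_smul_of_posDef (posDef_gram hR hF) (inv_ne_zero hs), inv_inv]

lemma mulE_covII_nuII (hR : R.PosDef) (hF : LinearIndependent ℝ F.col) (hs : s ≠ 0)
    (z : EuclideanSpace ℝ ι) : mulE (covII F R s) (nuII F R z s) = gls F R z := by
  rw [covII_eq_smul hR hF hs, nuII, gls]
  simp only [mulE, Matrix.mul_smul, Matrix.smul_mul, smul_mulVec, mulVec_smul, mulVec_mulVec,
    smul_smul, inv_mul_cancel₀ hs, one_smul, Matrix.mul_assoc]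

end PosteriorParameters

section InverseGamma

lemma invGamma_eq_withDensity_restrict (α q : ℝ) :
    invGamma α q = (volume.restrict (Set.Ioi 0)).withDensity fun x =>
      ENNReal.ofReal (q ^ α / Real.Gamma α * (Real.exp (-(q / x)) / x ^ (α + 1))) := by
  rw [invGamma, ← withDensity_indicator measurableSet_Ioi]
  congr with x
  by_cases hx : 0 < x <;> simp [invGammaPDF, hx]

lemma ae_pos_invGamma (α q : ℝ) : ∀ᵐ s ∂invGamma α q, 0 < s := by
  rw [invGamma_eq_withDensity_restrict]
  exact (withDensity_absolutelyContinuous _ _).ae_le (ae_restrict_mem measurableSet_Ioi)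

instance : SFinite jeffreys := by
  unfold jeffreys
  infer_instance

lemma ae_pos_jeffreys : ∀ᵐ s ∂jeffreys, 0 < s :=
  (withDensity_absolutelyContinuous _ _).ae_le (ae_restrict_mem measurableSet_Ioi)

lemma setLIntegral_Ioi_gammaPDF {α q : ℝ} (hα : 0 < α) (hq : 0 < q) :
    ∫⁻ x in Set.Ioi 0, gammaPDF α q x = 1 := by
  have hsplit := lintegral_add_compl (μ := volume) (gammaPDF α q) (measurableSet_Ioi (a := 0))
  rwa [lintegral_gammaPDF_eq_one hα hq, Set.compl_Ioi,
    Measure.restrict_congr_set Iio_ae_eq_Iic.symm, lintegral_gammaPDF_of_nonpos le_rfl,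
    add_zero] at hsplit

lemma setLIntegral_Ioi_comp_inv (f : ℝ → ℝ≥0∞) :
    ∫⁻ x in Set.Ioi 0, f x = ∫⁻ x in Set.Ioi 0, ENNReal.ofReal (x ^ 2)⁻¹ * f x⁻¹ := by
  have hcv := lintegral_image_eq_lintegral_abs_deriv_mul (s := Set.Ioi (0 : ℝ))
    (f := fun x => x⁻¹) (f' := fun x => -(x ^ 2)⁻¹) measurableSet_Ioi
    (fun x hx => (hasDerivAt_inv (ne_of_gt hx)).hasDerivWithinAt) inv_injective.injOn f
  have hinv : (Set.Ioi (0 : ℝ))⁻¹ = Set.Ioi 0 := by ext x; simp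
  simpa only [Set.image_inv_eq_inv, hinv, abs_neg, abs_inv, abs_sq] using hcv

theorem isProbabilityMeasure_invGamma {α q : ℝ} (hα : 0 < α) (hq : 0 < q) :
    IsProbabilityMeasure (invGamma α q) := by
  refine ⟨?_⟩
  rw [invGamma_eq_withDensity_restrict, withDensity_apply _ MeasurableSet.univ,
    Measure.restrict_univ, ← setLIntegral_Ioi_gammaPDF hα hq,
    setLIntegral_Ioi_comp_inv (gammaPDF α q)]
  refine setLIntegral_congr_fun measurableSet_Ioi fun x (hx : 0 < x) => ?_
  have : 0 < x ^ α := Real.rpow_pos_of_pos hx α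
  rw [gammaPDF, gammaPDFReal, if_pos (inv_pos.2 hx).le, ← ENNReal.ofReal_mul (by positivity),
    Real.inv_rpow hx.le, Real.rpow_add hx, Real.rpow_sub hx, Real.rpow_one, ← div_eq_mul_inv]
  congr 1
  field_simp

lemma withDensity_invGamma {α γ a q c : ℝ} (hα : 0 < α) (hγ : 0 < γ) (ha : 0 ≤ a) (hq : 0 ≤ q)
    (hc : 0 < c) :
    (invGamma α γ).withDensity
        (fun s => ENNReal.ofReal (c * (Real.exp (-(q / s)) / s ^ a))) =
      ENNReal.ofReal
          (c * (γ ^ α / Real.Gamma α) * (Real.Gamma (a + α) / (q + γ) ^ (a + α))) •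
        invGamma (a + α) (q + γ) := by
  have := Real.Gamma_pos_of_pos hα
  have := Real.Gamma_pos_of_pos (add_pos_of_nonneg_of_pos ha hα)
  rw [invGamma_eq_withDensity_restrict, invGamma_eq_withDensity_restrict,
    ← withDensity_mul _ (by fun_prop) (by fun_prop), ← withDensity_smul _ (by fun_prop)]
  refine withDensity_congr_ae ?_
  filter_upwards [ae_restrict_mem measurableSet_Ioi] with s (hs : 0 < s)
  have : 0 < (q + γ) ^ (a + α) := Real.rpow_pos_of_pos (by positivity) _
  simp only [Pi.mul_apply, Pi.smul_apply, smul_eq_mul]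
  rw [← ENNReal.ofReal_mul (by positivity), ← ENNReal.ofReal_mul (by positivity), add_assoc,
    Real.rpow_add hs a, add_div, neg_add, Real.exp_add]
  congr 1
  field_simp

lemma withDensity_jeffreys {a q c : ℝ} (ha : 0 < a) (hq : 0 < q) (hc : 0 < c) :
    jeffreys.withDensity (fun s => ENNReal.ofReal (c * (Real.exp (-(q / s)) / s ^ a))) =
      ENNReal.ofReal (c * (Real.Gamma a / q ^ a)) • invGamma a q := by
  have := Real.Gamma_pos_of_pos ha
  have : 0 < q ^ a := Real.rpow_pos_of_pos hq a
  rw [jeffreys, invGamma_eq_withDensity_restrict, ← withDensity_mul _ (by fun_prop) (by fun_prop),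
    ← withDensity_smul _ (by fun_prop)]
  refine withDensity_congr_ae ?_
  filter_upwards [ae_restrict_mem measurableSet_Ioi] with s (hs : 0 < s)
  simp only [Pi.mul_apply, Pi.smul_apply, smul_eq_mul]
  rw [← ENNReal.ofReal_mul (by positivity), ← ENNReal.ofReal_mul (by positivity),
    Real.rpow_add hs, Real.rpow_one]
  congr 1
  field_simp

theorem bayes_invGamma {α γ a q c : ℝ} (hα : 0 < α) (hγ : 0 < γ) (ha : 0 ≤ a) (hq : 0 ≤ q)
    (hc : 0 < c) {L : ℝ → ℝ} (hL : ∀ s, 0 < s → L s = c * (Real.exp (-(q / s)) / s ^ a)) :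
    bayes (invGamma α γ) L = invGamma (a + α) (q + γ) := by
  have := Real.Gamma_pos_of_pos hα
  have := Real.Gamma_pos_of_pos (add_pos_of_nonneg_of_pos ha hα)
  have := isProbabilityMeasure_invGamma (add_pos_of_nonneg_of_pos ha hα)
    (add_pos_of_nonneg_of_pos hq hγ)
  have : 0 < (q + γ) ^ (a + α) := Real.rpow_pos_of_pos (by positivity) _
  refine (bayes_eq_of_withDensity_eq_smul
    (c := c * (γ ^ α / Real.Gamma α) * (Real.Gamma (a + α) / (q + γ) ^ (a + α)))
    (by positivity) ?_).2
  rw [← withDensity_invGamma hα hγ ha hq hc]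
  refine withDensity_congr_ae ?_
  filter_upwards [ae_pos_invGamma α γ] with s hs
  rw [hL s hs]

theorem bayes_jeffreys {a q c : ℝ} (ha : 0 < a) (hq : 0 < q) (hc : 0 < c) {L : ℝ → ℝ}
    (hL : ∀ s, 0 < s → L s = c * (Real.exp (-(q / s)) / s ^ a)) :
    evidence jeffreys L = ENNReal.ofReal (c * (Real.Gamma a / q ^ a)) ∧
      bayes jeffreys L = invGamma a q := by
  have := Real.Gamma_pos_of_pos ha
  have := isProbabilityMeasure_invGamma ha hq
  refine bayes_eq_of_withDensity_eq_smul (by positivity) ?_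
  rw [← withDensity_jeffreys ha hq hc]
  refine withDensity_congr_ae ?_
  filter_upwards [ae_pos_jeffreys] with s hs
  rw [hL s hs]

end InverseGamma

section Measurability

variable {𝓐 ι κ : Type*} [MeasurableSpace 𝓐] [Fintype κ]

lemma measurable_mulE {F : 𝓐 → Matrix ι κ ℝ} (hF : ∀ i j, Measurable fun a => F a i j)
    {β : 𝓐 → EuclideanSpace ℝ κ} (hβ : Measurable β) : Measurable fun a => mulE (F a) (β a) := by
  have hmulVec : Measurable fun a => F a *ᵥ (β a).ofLp := by
    refine measurable_pi_iff.2 fun i => ?_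
    simp only [mulVec, dotProduct]
    fun_prop
  unfold mulE
  fun_prop

variable [Fintype ι]

lemma measurable_quad (M : Matrix ι ι ℝ) : Measurable (quad M) := by
  unfold quad
  simp only [mulVec, dotProduct]
  fun_prop

lemma measurable_gaussDensity_smul [DecidableEq ι] {R : Matrix ι ι ℝ} (hR : R.PosDef)
    {m z : 𝓐 → EuclideanSpace ℝ ι} {s : 𝓐 → ℝ} (hm : Measurable m) (hs : Measurable s)
    (hz : Measurable z) : Measurable fun a => gaussDensity (m a) (s a • R) (z a) := by
  -- Pulling the scalar out of the inverse avoids the measurability of matrix inversion.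
  have hquad (a : 𝓐) : quad (s a • R)⁻¹ (z a - m a) = (s a)⁻¹ * quad R⁻¹ (z a - m a) := by
    rw [← quad_smul]
    by_cases h : s a = 0
    · simp [h]
    · rw [inv_smul_of_posDef hR h]
  have hmeas : Measurable fun a => quad R⁻¹ (z a - m a) := (measurable_quad _).comp (hz.sub hm)
  simp only [gaussDensity, hquad, det_smul]
  fun_prop

end Measurability

section Conjugacy

variable {ι κ : Type*} [Fintype ι] [DecidableEq ι] [Fintype κ] [DecidableEq κ]

/-- The normalizing constant of the Gaussian density with covariance `R`. -/
def gaussConst (R : Matrix ι ι ℝ) : ℝ := (Real.sqrt ((2 * Real.pi) ^ Fintype.card ι * R.det))⁻¹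

lemma gaussConst_pos {R : Matrix ι ι ℝ} (hR : R.PosDef) : 0 < gaussConst R := by
  have := hR.det_pos
  unfold gaussConst
  positivity

lemma gaussDensity_smul {R : Matrix ι ι ℝ} (hR : R.PosDef) {s : ℝ} (hs : 0 < s)
    (m z : EuclideanSpace ℝ ι) :
    gaussDensity m (s • R) z = gaussConst R *
      (Real.exp (-(quad R⁻¹ (z - m) / 2 / s)) / s ^ ((Fintype.card ι : ℝ) / 2)) := by
  have hsqrt : Real.sqrt (s ^ Fintype.card ι) = s ^ ((Fintype.card ι : ℝ) / 2) := by
    rw [Real.sqrt_eq_rpow, ← Real.rpow_natCast_mul hs.le, mul_one_div]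
  rw [gaussDensity, gaussConst, det_smul, mul_left_comm, Real.sqrt_mul (by positivity), hsqrt,
    inv_smul_of_posDef hR hs.ne', quad_smul, mul_inv]
  ring_nf

lemma withDensity_const_mul_gaussDensity {c : ℝ} (hc : 0 ≤ c) (m : EuclideanSpace ℝ ι)
    {S : Matrix ι ι ℝ} (hS : S.PosDef) :
    volume.withDensity (fun x => ENNReal.ofReal (c * gaussDensity m S x)) =
      ENNReal.ofReal c • multivariateGaussian m S := by
  rw [multivariateGaussian_eq_withDensity m hS,
    ← withDensity_smul _ (measurable_gaussDensity m S).ennreal_ofReal]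
  simp only [ENNReal.ofReal_mul hc, Pi.smul_def, smul_eq_mul]

variable {F : Matrix ι κ ℝ} {R : Matrix ι ι ℝ} {V W : Matrix κ κ ℝ} {s : ℝ}

theorem gaussDensity_mulE_mul_exp_eq (hR : R.PosDef) (hW : W.IsSymm)
    (hH : (Fᵀ * R⁻¹ * F + W).PosDef) (hs : 0 < s) (b β : EuclideanSpace ℝ κ)
    (z : EuclideanSpace ℝ ι) :
    gaussDensity (mulE F β) (s • R) z * Real.exp (-(quad W (β - b) / 2 / s)) =
      gaussConst R / gaussConst (Fᵀ * R⁻¹ * F + W)⁻¹ *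
          (Real.exp (-(ridgeResidual F R W b z / 2 / s)) /
            s ^ (((Fintype.card ι : ℝ) - Fintype.card κ) / 2)) *
        gaussDensity (ridge F R W b z) (s • (Fᵀ * R⁻¹ * F + W)⁻¹) β := by
  have hconst := gaussConst_pos hH.inv
  have hexp : Real.exp (-(quad R⁻¹ (z - mulE F β) / 2 / s)) *
        Real.exp (-(quad W (β - b) / 2 / s)) =
      Real.exp (-(ridgeResidual F R W b z / 2 / s)) *
        Real.exp (-(quad (Fᵀ * R⁻¹ * F + W) (β - ridge F R W b z) / 2 / s)) := by
    rw [← Real.exp_add, ← Real.exp_add]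
    congr 1
    linear_combination -(quad_sub_mulE_add_quad_sub_eq_ridge hR hW hH b z β) / 2 / s
  rw [gaussDensity_smul hR hs, gaussDensity_smul hH.inv hs,
    nonsing_inv_nonsing_inv _ hH.det_pos.ne'.isUnit, sub_div, Real.rpow_sub hs, mul_assoc,
    div_mul_eq_mul_div, hexp]
  field_simp

/-- The normalizing constant of the conjugate Gaussian update: the marginal likelihood of the
observations is this constant times `exp (-Q / (2 s)) / s ^ (n / 2)`. -/
def conjugateConst (F : Matrix ι κ ℝ) (R : Matrix ι ι ℝ) (V : Matrix κ κ ℝ) : ℝ :=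
  gaussConst R * gaussConst V / gaussConst (Fᵀ * R⁻¹ * F + V⁻¹)⁻¹

lemma conjugateConst_pos (F : Matrix ι κ ℝ) (hR : R.PosDef) (hV : V.PosDef) :
    0 < conjugateConst F R V :=
  div_pos (mul_pos (gaussConst_pos hR) (gaussConst_pos hV))
    (gaussConst_pos (posDef_gram_add_inv F hR hV).inv)

lemma posDef_covI (F : Matrix ι κ ℝ) (hR : R.PosDef) (hV : V.PosDef) (hs : 0 < s) :
    (covI F R V s).PosDef := by
  rw [covI_eq_smul F hR hV hs.ne']
  exact (posDef_gram_add_inv F hR hV).inv.smul hs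

lemma gaussDensity_mul_gaussDensity_mulE (F : Matrix ι κ ℝ) (hR : R.PosDef) (hV : V.PosDef)
    (hs : 0 < s) (b β : EuclideanSpace ℝ κ) (z : EuclideanSpace ℝ ι) :
    gaussDensity b (s • V) β * gaussDensity (mulE F β) (s • R) z =
      conjugateConst F R V * (Real.exp (-(ridgeResidual F R V⁻¹ b z / 2 / s)) /
          s ^ ((Fintype.card ι : ℝ) / 2)) *
        gaussDensity (mulE (covI F R V s) (nuI F R V b z s)) (covI F R V s) β := by
  have hproduct := gaussDensity_mulE_mul_exp_eq hR (isSymm_of_posDef hV.inv)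
    (posDef_gram_add_inv F hR hV) hs b β z
  have hpow := Real.rpow_pos_of_pos hs ((Fintype.card κ : ℝ) / 2)
  rw [sub_div, Real.rpow_sub hs] at hproduct
  rw [mulE_covI_nuI F hR hV hs.ne', covI_eq_smul F hR hV hs.ne', gaussDensity_smul hV hs,
    mul_assoc, div_mul_eq_mul_div, mul_comm (Real.exp _), hproduct, conjugateConst]
  field_simp

/-- The density at `z` of the observations given the variance `s`, when the regression
coefficients are integrated out against their Gaussian prior. -/
def marginalLikelihood (F : Matrix ι κ ℝ) (R : Matrix ι ι ℝ) (V : Matrix κ κ ℝ)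
    (b : EuclideanSpace ℝ κ) (z : EuclideanSpace ℝ ι) (s : ℝ) : ℝ :=
  (evidence volume fun β => gaussDensity b (s • V) β * gaussDensity (mulE F β) (s • R) z).toReal

lemma marginalLikelihood_eq (F : Matrix ι κ ℝ) (hR : R.PosDef) (hV : V.PosDef) (hs : 0 < s)
    (b : EuclideanSpace ℝ κ) (z : EuclideanSpace ℝ ι) :
    marginalLikelihood F R V b z s =
      conjugateConst F R V * (Real.exp (-(ridgeResidual F R V⁻¹ b z / 2 / s)) /
        s ^ ((Fintype.card ι : ℝ) / 2)) := by
  have hc := conjugateConst_pos F hR hV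
  have hnonneg : 0 ≤ conjugateConst F R V *
      (Real.exp (-(ridgeResidual F R V⁻¹ b z / 2 / s)) / s ^ ((Fintype.card ι : ℝ) / 2)) := by
    positivity
  simp only [marginalLikelihood, evidence, gaussDensity_mul_gaussDensity_mulE F hR hV hs,
    ENNReal.ofReal_mul hnonneg]
  rw [lintegral_const_mul' _ _ ENNReal.ofReal_ne_top,
    lintegral_gaussDensity _ (posDef_covI F hR hV hs), mul_one, ENNReal.toReal_ofReal hnonneg]

lemma measurable_marginalLikelihood {𝓐 : Type*} [MeasurableSpace 𝓐] {F : 𝓐 → Matrix ι κ ℝ}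
    (hF : ∀ i j, Measurable fun a => F a i j) (hR : R.PosDef) (hV : V.PosDef)
    (b : EuclideanSpace ℝ κ) {z : 𝓐 → EuclideanSpace ℝ ι} (hz : Measurable z) {s : 𝓐 → ℝ}
    (hs : Measurable s) : Measurable fun a => marginalLikelihood (F a) R V b (z a) (s a) := by
  have hprior : Measurable fun q : 𝓐 × EuclideanSpace ℝ κ => gaussDensity b (s q.1 • V) q.2 :=
    measurable_gaussDensity_smul hV (by fun_prop) (by fun_prop) (by fun_prop)
  have hmean : Measurable fun q : 𝓐 × EuclideanSpace ℝ κ => mulE (F q.1) q.2 :=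
    measurable_mulE (by fun_prop) (by fun_prop)
  have hlik : Measurable fun q : 𝓐 × EuclideanSpace ℝ κ =>
      gaussDensity (mulE (F q.1) q.2) (s q.1 • R) (z q.1) :=
    measurable_gaussDensity_smul hR hmean (by fun_prop) (by fun_prop)
  exact (hprior.mul hlik).ennreal_ofReal.lintegral_prod_right'.ennreal_toReal

theorem bayes_multivariateGaussian (F : Matrix ι κ ℝ) (hR : R.PosDef) (hV : V.PosDef)
    (hs : 0 < s) (b : EuclideanSpace ℝ κ) (z : EuclideanSpace ℝ ι) :
    evidence (multivariateGaussian b (s • V)) (fun β => gaussDensity (mulE F β) (s • R) z) =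
        ENNReal.ofReal (marginalLikelihood F R V b z s) ∧
      bayes (multivariateGaussian b (s • V)) (fun β => gaussDensity (mulE F β) (s • R) z) =
        multivariateGaussian (mulE (covI F R V s) (nuI F R V b z s)) (covI F R V s) := by
  have hmean : Measurable (mulE F) := measurable_mulE (by fun_prop) measurable_id
  have hlik : Measurable fun β => gaussDensity (mulE F β) (s • R) z :=
    measurable_gaussDensity_smul hR hmean (by fun_prop) (by fun_prop)
  have hpos : 0 < marginalLikelihood F R V b z s := by
    have := conjugateConst_pos F hR hV
    rw [marginalLikelihood_eq F hR hV hs]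
    positivity
  refine bayes_eq_of_withDensity_eq_smul hpos ?_
  rw [multivariateGaussian_eq_withDensity b (hV.smul hs),
    ← withDensity_mul _ (measurable_gaussDensity _ _).ennreal_ofReal hlik.ennreal_ofReal,
    ← withDensity_const_mul_gaussDensity hpos.le _ (posDef_covI F hR hV hs)]
  simp only [marginalLikelihood_eq F hR hV hs, ← gaussDensity_mul_gaussDensity_mulE F hR hV hs,
    Pi.mul_def, ENNReal.ofReal_mul (gaussDensity_nonneg _ _ _)]

theorem bayes_invGamma_marginalLikelihood {α γ : ℝ} (hα : 0 < α) (hγ : 0 < γ) (hR : R.PosDef)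
    (hV : V.PosDef) (hF : LinearIndependent ℝ F.col) (b : EuclideanSpace ℝ κ)
    (z : EuclideanSpace ℝ ι) :
    bayes (invGamma α γ) (marginalLikelihood F R V b z) =
      invGamma ((Fintype.card ι : ℝ) / 2 + α) (scaleI F R V b γ z / 2) := by
  have hQ : 0 ≤ ridgeResidual F R V⁻¹ b z := ridgeResidual_nonneg hR hV.inv.posSemidef b z
  rw [bayes_invGamma hα hγ (by positivity) (div_nonneg hQ zero_le_two) (conjugateConst_pos F hR hV)
    fun s hs => marginalLikelihood_eq F hR hV hs b z, scaleI_eq_two_mul_add_ridgeResidual hR hV hF]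
  ring_nf

end Conjugacy

lemma card_lt_card_of_notMem_range {ι κ : Type*} [Fintype ι] [Fintype κ] {F : Matrix ι κ ℝ}
    (hF : LinearIndependent ℝ F.col) {z : EuclideanSpace ℝ ι} (hz : z ∉ Set.range (mulE F)) :
    Fintype.card κ < Fintype.card ι := by
  have hinj : Function.Injective F.mulVecLin := mulVec_injective_iff.2 hF
  have hle : Fintype.card κ ≤ Fintype.card ι := by
    simpa using LinearMap.finrank_le_finrank_of_injective hinj
  refine hle.lt_of_ne fun heq => hz ?_
  obtain ⟨v, hv⟩ := (LinearMap.injective_iff_surjective_of_finrank_eq_finrank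
    (f := F.mulVecLin) (by simpa using heq)).1 hinj z.ofLp
  exact ⟨WithLp.toLp 2 v, congrArg (WithLp.toLp 2) hv⟩

section FlatPrior

variable {ι κ : Type*} [Fintype ι] [DecidableEq ι] [Fintype κ] [DecidableEq κ]
  {F : Matrix ι κ ℝ} {R : Matrix ι ι ℝ}

/-- The normalizing constant of the Gaussian update from the flat prior: the evidence of the
observations is this constant times `exp (-Q / (2 s)) / s ^ ((n - k) / 2)`. -/
def flatConst (F : Matrix ι κ ℝ) (R : Matrix ι ι ℝ) : ℝ :=
  gaussConst R / gaussConst (Fᵀ * R⁻¹ * F)⁻¹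

lemma flatConst_pos (hR : R.PosDef) (hF : LinearIndependent ℝ F.col) : 0 < flatConst F R :=
  div_pos (gaussConst_pos hR) (gaussConst_pos (posDef_gram hR hF).inv)

lemma gaussDensity_mulE_eq (hR : R.PosDef) (hF : LinearIndependent ℝ F.col) {s : ℝ} (hs : 0 < s)
    (β : EuclideanSpace ℝ κ) (z : EuclideanSpace ℝ ι) :
    gaussDensity (mulE F β) (s • R) z =
      flatConst F R * (Real.exp (-(scaleII F R z / 2 / s)) /
          s ^ (((Fintype.card ι : ℝ) - Fintype.card κ) / 2)) *
        gaussDensity (mulE (covII F R s) (nuII F R z s)) (covII F R s) β := by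
  have hproduct := gaussDensity_mulE_mul_exp_eq (W := 0) hR (by simp [IsSymm])
    (by simpa using posDef_gram hR hF) hs 0 β z
  rw [mulE_covII_nuII hR hF hs.ne', covII_eq_smul hR hF hs.ne', flatConst]
  simpa only [quad_zero, zero_div, neg_zero, Real.exp_zero, mul_one, add_zero, ridge_zero,
    ridgeResidual_zero hR hF] using hproduct

lemma withDensity_gaussDensity_mulE (hR : R.PosDef) (hF : LinearIndependent ℝ F.col) {s : ℝ}
    (hs : 0 < s) (z : EuclideanSpace ℝ ι) :
    volume.withDensity (fun β => ENNReal.ofReal (gaussDensity (mulE F β) (s • R) z)) =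
      ENNReal.ofReal (flatConst F R * (Real.exp (-(scaleII F R z / 2 / s)) /
          s ^ (((Fintype.card ι : ℝ) - Fintype.card κ) / 2))) •
        multivariateGaussian (mulE (covII F R s) (nuII F R z s)) (covII F R s) := by
  have hc := flatConst_pos hR hF
  have hcov : (covII F R s).PosDef := by
    rw [covII_eq_smul hR hF hs.ne']
    exact (posDef_gram hR hF).inv.smul hs
  simp only [gaussDensity_mulE_eq hR hF hs]
  exact withDensity_const_mul_gaussDensity (by positivity) _ hcov

lemma evidence_volume (hR : R.PosDef) (hF : LinearIndependent ℝ F.col) {s : ℝ} (hs : 0 < s)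
    (z : EuclideanSpace ℝ ι) :
    evidence volume (fun β => gaussDensity (mulE F β) (s • R) z) =
      ENNReal.ofReal (flatConst F R * (Real.exp (-(scaleII F R z / 2 / s)) /
        s ^ (((Fintype.card ι : ℝ) - Fintype.card κ) / 2))) := by
  have hc := flatConst_pos hR hF
  exact (bayes_eq_of_withDensity_eq_smul (by positivity)
    (withDensity_gaussDensity_mulE hR hF hs z)).1

theorem bayes_volume (hR : R.PosDef) (hF : LinearIndependent ℝ F.col) {s : ℝ} (hs : 0 < s)
    (z : EuclideanSpace ℝ ι) :
    0 < evidence volume (fun β => gaussDensity (mulE F β) (s • R) z) ∧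
      evidence volume (fun β => gaussDensity (mulE F β) (s • R) z) < ⊤ ∧
      bayes volume (fun β => gaussDensity (mulE F β) (s • R) z) =
        multivariateGaussian (mulE (covII F R s) (nuII F R z s)) (covII F R s) := by
  have hc := flatConst_pos hR hF
  rw [evidence_volume hR hF hs]
  exact ⟨ENNReal.ofReal_pos.2 (by positivity), ENNReal.ofReal_lt_top,
    (bayes_eq_of_withDensity_eq_smul (by positivity)
      (withDensity_gaussDensity_mulE hR hF hs z)).2⟩

theorem bayes_prod_jeffreys (hR : R.PosDef) (hF : LinearIndependent ℝ F.col)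
    {z : EuclideanSpace ℝ ι} (hz : z ∉ Set.range (mulE F)) :
    0 < evidence (volume.prod jeffreys) (fun q => gaussDensity (mulE F q.1) (q.2 • R) z) ∧
      evidence (volume.prod jeffreys) (fun q => gaussDensity (mulE F q.1) (q.2 • R) z) < ⊤ ∧
      (bayes (volume.prod jeffreys)
          (fun q => gaussDensity (mulE F q.1) (q.2 • R) z)).map Prod.snd =
        invGamma (((Fintype.card ι : ℝ) - Fintype.card κ) / 2) (scaleII F R z / 2) := by
  have hQ := half_pos (scaleII_pos hR hF hz)
  have hcard : 0 < ((Fintype.card ι : ℝ) - Fintype.card κ) / 2 :=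
    half_pos (sub_pos.2 (by exact_mod_cast card_lt_card_of_notMem_range hF hz))
  have hc := flatConst_pos hR hF
  have := Real.Gamma_pos_of_pos hcard
  have hL : Measurable fun q : EuclideanSpace ℝ κ × ℝ =>
      gaussDensity (mulE F q.1) (q.2 • R) z :=
    measurable_gaussDensity_smul hR (measurable_mulE (by fun_prop) (by fun_prop)) (by fun_prop)
      (by fun_prop)
  obtain ⟨hprod, hmap⟩ := bayes_prod_map_snd hL
    (ae_pos_jeffreys.mono fun s hs => evidence_volume hR hF hs z)
  obtain ⟨hevidence, hbayes⟩ := bayes_jeffreys hcard hQ hc fun s _ => rfl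
  rw [hmap, hbayes, hprod, hevidence]
  exact ⟨ENNReal.ofReal_pos.2 (by positivity), ENNReal.ofReal_lt_top, rfl⟩

end FlatPrior

section Posterior

variable {Ω 𝓤 ι κ : Type*} [MeasurableSpace Ω] [MeasurableSpace 𝓤]
  [Fintype ι] [DecidableEq ι] [Fintype κ] [DecidableEq κ]
  {P : Measure Ω} [IsFiniteMeasure P] {F : 𝓤 → Matrix ι κ ℝ} {σ : 𝓤 → ℝ}
  {R : Matrix ι ι ℝ} {V : Matrix κ κ ℝ} {b : EuclideanSpace ℝ κ}
  {U : Ω → 𝓤} {B : Ω → EuclideanSpace ℝ κ} {Z : Ω → EuclideanSpace ℝ ι}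

theorem HasCondDensity.condDistrib_coeff_ae_eq
    (h : HasCondDensity P Z (fun ω => (U ω, B ω)) volume
      fun q z => gaussDensity (mulE (F q.1) q.2) (σ q.1 • R) z)
    (hR : R.PosDef) (hV : V.PosDef) (hσ : ∀ᵐ u ∂P.map U, 0 < σ u)
    (hprior : condDistrib B U P =ᵐ[P.map U] fun u => multivariateGaussian b (σ u • V)) :
    ∀ᵐ y ∂P.map (fun ω => (U ω, Z ω)), condDistrib B (fun ω => (U ω, Z ω)) P y =
      multivariateGaussian
        (mulE (covI (F y.1) R V (σ y.1)) (nuI (F y.1) R V b y.2 (σ y.1)))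
        (covI (F y.1) R V (σ y.1)) := by
  filter_upwards [h.condDistrib_ae_eq_bayes, ae_map_prodMk_of_ae_map_fst h.measurable_left hσ,
    ae_map_prodMk_of_ae_map_fst h.measurable_left hprior] with y hbayes hpos hcond
  rw [hbayes, hcond, (bayes_multivariateGaussian (F y.1) hR hV hpos b y.2).2]

theorem HasCondDensity.integrate_coeff
    (h : HasCondDensity P Z (fun ω => (U ω, B ω)) volume
      fun q z => gaussDensity (mulE (F q.1) q.2) (σ q.1 • R) z)
    (hF : ∀ i j, Measurable fun u => F u i j) (hσm : Measurable σ)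
    (hR : R.PosDef) (hV : V.PosDef) (hσ : ∀ᵐ u ∂P.map U, 0 < σ u)
    (hprior : condDistrib B U P =ᵐ[P.map U] fun u => multivariateGaussian b (σ u • V)) :
    HasCondDensity P Z U volume fun u z => marginalLikelihood (F u) R V b z (σ u) := by
  refine h.of_evidence_eq (measurable_marginalLikelihood (by fun_prop) hR hV b (by fun_prop)
    (by fun_prop)) ?_
  filter_upwards [hσ, hprior] with u hpos hcond z
  rw [hcond, (bayes_multivariateGaussian (F u) hR hV hpos b z).1]

theorem HasCondDensity.condDistrib_variance_ae_eq {S : Ω → ℝ} {α γ : ℝ}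
    (h : HasCondDensity P Z (fun ω => (U ω, S ω)) volume
      fun q z => marginalLikelihood (F q.1) R V b z q.2)
    (hα : 0 < α) (hγ : 0 < γ) (hR : R.PosDef) (hV : V.PosDef)
    (hprior : condDistrib S U P =ᵐ[P.map U] fun _ => invGamma α γ) :
    ∀ᵐ y ∂P.map (fun ω => (U ω, Z ω)), LinearIndependent ℝ (F y.1).col →
      condDistrib S (fun ω => (U ω, Z ω)) P y =
        invGamma ((Fintype.card ι : ℝ) / 2 + α) (scaleI (F y.1) R V b γ y.2 / 2) := by
  filter_upwards [h.condDistrib_ae_eq_bayes,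
    ae_map_prodMk_of_ae_map_fst h.measurable_left hprior] with y hbayes hcond hF
  rw [hbayes, hcond, bayes_invGamma_marginalLikelihood hα hγ hR hV hF]

theorem HasCondDensity.condDistrib_variance_ae_eq_of_map {S : Ω → ℝ} {α γ : ℝ} {F : Matrix ι κ ℝ}
    (h : HasCondDensity P Z S volume fun s z => marginalLikelihood F R V b z s)
    (hα : 0 < α) (hγ : 0 < γ) (hR : R.PosDef) (hV : V.PosDef)
    (hF : LinearIndependent ℝ F.col) (hprior : P.map S = invGamma α γ) :
    ∀ᵐ z ∂P.map Z, condDistrib S Z P z =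
      invGamma ((Fintype.card ι : ℝ) / 2 + α) (scaleI F R V b γ z / 2) := by
  filter_upwards [h.condDistrib_ae_eq_bayes_map] with z hbayes
  rw [hbayes, hprior, bayes_invGamma_marginalLikelihood hα hγ hR hV hF]

end Posterior

section Model

variable {Ω : Type*} {d p₁ p₂ n₁ n₂ : ℕ} {D : Set (EuclideanSpace ℝ (Fin d))}
  {f₁ : D → Fin p₁ → ℝ} {f₂ : D → Fin p₂ → ℝ} {r₁ r₂ : EuclideanSpace ℝ (Fin d) → ℝ}
  {x₁ : Fin n₁ → D} {x₂ : Fin n₂ → D} {e : Fin n₂ → Fin n₁}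

/-- The part `ρ z₁(D₂)` of the second level that is inherited from the first one. -/
def carry (e : Fin n₂ → Fin n₁) (u : EuclideanSpace ℝ (Fin n₁))
    (l : EuclideanSpace ℝ (Unit ⊕ Fin p₂)) : EuclideanSpace ℝ (Fin n₂) :=
  WithLp.toLp 2 fun i => rho l * u (e i)

lemma sample_autoregressive {Z₁ Z₂ δ : D → Ω → ℝ} {l : Ω → EuclideanSpace ℝ (Unit ⊕ Fin p₂)}
    (h : ∀ x ω, Z₂ x ω = rho (l ω) * Z₁ x ω + δ x ω) (he : ∀ i, x₂ i = x₁ (e i)) (ω : Ω) :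
    sample Z₂ x₂ ω = carry e (sample Z₁ x₁ ω) (l ω) + sample δ x₂ ω := by
  ext i
  simp [sample, carry, h, he]

lemma measurable_carry (e : Fin n₂ → Fin n₁) :
    Measurable fun q : EuclideanSpace ℝ (Fin n₁) × EuclideanSpace ℝ (Unit ⊕ Fin p₂) =>
      carry e q.1 q.2 := by
  unfold carry rho
  fun_prop

lemma measurable_beta₂ : Measurable (beta₂ : EuclideanSpace ℝ (Unit ⊕ Fin p₂) → _) := by
  unfold beta₂
  fun_prop

lemma measurable_design₂ (f₂ : D → Fin p₂ → ℝ) (x₂ : Fin n₂ → D) (e : Fin n₂ → Fin n₁)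
    (i : Fin n₂) (j : Unit ⊕ Fin p₂) : Measurable fun u => design₂ f₂ x₂ e u i j := by
  cases j <;> simp only [design₂, of_apply, Sum.elim_inl, Sum.elim_inr] <;> fun_prop

lemma mulE_design₂ (f₂ : D → Fin p₂ → ℝ) (x₂ : Fin n₂ → D) (e : Fin n₂ → Fin n₁)
    (u : EuclideanSpace ℝ (Fin n₁)) (l : EuclideanSpace ℝ (Unit ⊕ Fin p₂)) :
    mulE (design₂ f₂ x₂ e u) l = carry e u l + mulE (design f₂ x₂) (beta₂ l) := by
  ext i
  simp [mulE, design₂, carry, design, beta₂, rho, mulVec, dotProduct, mul_comm]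

lemma gaussDensity_sub_carry (f₂ : D → Fin p₂ → ℝ) (x₂ : Fin n₂ → D) (e : Fin n₂ → Fin n₁)
    (u : EuclideanSpace ℝ (Fin n₁)) (l : EuclideanSpace ℝ (Unit ⊕ Fin p₂))
    (S : Matrix (Fin n₂) (Fin n₂) ℝ) (z : EuclideanSpace ℝ (Fin n₂)) :
    gaussDensity (mulE (design f₂ x₂) (beta₂ l)) S (z - carry e u l) =
      gaussDensity (mulE (design₂ f₂ x₂ e u) l) S z := by
  rw [gaussDensity, gaussDensity, mulE_design₂, sub_sub]

variable [MeasurableSpace Ω]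

lemma measurable_sample {Z : D → Ω → ℝ} (hZ : ∀ x, Measurable (Z x)) {n : ℕ} (x : Fin n → D) :
    Measurable (sample Z x) := by
  unfold sample
  fun_prop

theorem FixedModel.map_sample {P : Measure Ω} {θ : Param p₁ p₂} {Z₁ Z₂ δ : D → Ω → ℝ}
    (h : FixedModel P f₁ f₂ r₁ r₂ θ Z₁ Z₂ δ) (he : ∀ i, x₂ i = x₁ (e i))
    (hR₁ : (corr r₁ x₁).PosDef) (hR₂ : (corr r₂ x₂).PosDef) (hs₁ : 0 < θ.1) (hs₂ : 0 < θ.2.2.1) :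
    P.map (fun ω => (sample Z₁ x₁ ω, sample Z₂ x₂ ω)) =
      volume.withDensity fun y => ENNReal.ofReal
        (gaussDensity (mulE (design f₁ x₁) θ.2.1) (θ.1 • corr r₁ x₁) y.1 *
          gaussDensity (mulE (design₂ f₂ x₂ e y.1) θ.2.2.2) (θ.2.2.1 • corr r₂ x₂) y.2) := by
  have hc : Measurable fun u => carry e u θ.2.2.2 :=
    (measurable_carry e).comp measurable_prodMk_right
  have hL₁ := (measurable_gaussDensity (mulE (design f₁ x₁) θ.2.1)
    (θ.1 • corr r₁ x₁)).ennreal_ofReal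
  have hL₂ := (measurable_gaussDensity (mulE (design f₂ x₂) (beta₂ θ.2.2.2))
    (θ.2.2.1 • corr r₂ x₂)).ennreal_ofReal
  have hL : Measurable fun q : EuclideanSpace ℝ (Fin n₁) × EuclideanSpace ℝ (Fin n₂) =>
      ENNReal.ofReal (gaussDensity (mulE (design f₁ x₁) θ.2.1) (θ.1 • corr r₁ x₁) q.1) *
        ENNReal.ofReal (gaussDensity (mulE (design f₂ x₂) (beta₂ θ.2.2.2))
          (θ.2.2.1 • corr r₂ x₂) q.2) :=
    (hL₁.comp measurable_fst).mul (hL₂.comp measurable_snd)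
  have hsample : (fun ω => (sample Z₁ x₁ ω, sample Z₂ x₂ ω)) =
      (fun q => (q.1, carry e q.1 θ.2.2.2 + q.2)) ∘ fun ω => (sample Z₁ x₁ ω, sample δ x₂ ω) :=
    funext fun ω => Prod.ext rfl
      (sample_autoregressive (l := fun _ => θ.2.2.2) h.autoregressive he ω)
  rw [hsample, ← Measure.map_map (by fun_prop)
      ((measurable_sample h.measurable_Z₁ x₁).prodMk (measurable_sample h.measurable_δ x₂)),
    h.law, pairLaw, multivariateGaussian_eq_withDensity _ (hR₁.smul hs₁),
    multivariateGaussian_eq_withDensity _ (hR₂.smul hs₂), prod_withDensity hL₁ hL₂,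
    map_add_withDensity_prod hc hL]
  simp only [gaussDensity_sub_carry, ENNReal.ofReal_mul (gaussDensity_nonneg _ _ _),
    Measure.volume_eq_prod]

variable {P : Measure Ω} [IsFiniteMeasure P] {s₁ : Ω → ℝ} {β₁ : Ω → EuclideanSpace ℝ (Fin p₁)}
  {s₂ : Ω → ℝ} {l : Ω → EuclideanSpace ℝ (Unit ⊕ Fin p₂)} {Z₁ Z₂ δ : D → Ω → ℝ}
  {b₁ : EuclideanSpace ℝ (Fin p₁)} {v₁ : Fin p₁ → ℝ} {α₁ γ₁ : ℝ}
  {bl : EuclideanSpace ℝ (Unit ⊕ Fin p₂)} {vl : Unit ⊕ Fin p₂ → ℝ} {α₂ γ₂ : ℝ}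

lemma InformativePriors.ae_pos_s₁ {z₁ : Ω → EuclideanSpace ℝ (Fin n₁)}
    (h : InformativePriors P s₁ β₁ s₂ l z₁ b₁ v₁ α₁ γ₁ bl vl α₂ γ₂) :
    ∀ᵐ s ∂P.map s₁, 0 < s := by
  rw [h.prior_s₁]
  exact ae_pos_invGamma α₁ γ₁

lemma InformativePriors.ae_pos_s₂ {z₁ : Ω → EuclideanSpace ℝ (Fin n₁)}
    (h : InformativePriors P s₁ β₁ s₂ l z₁ b₁ v₁ α₁ γ₁ bl vl α₂ γ₂) (hs₂ : Measurable s₂) :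
    ∀ᵐ y ∂P.map (fun ω => (z₁ ω, s₂ ω)), 0 < y.2 := by
  rw [← compProd_map_condDistrib hs₂.aemeasurable,
    Measure.ae_compProd_iff (measurableSet_lt measurable_const measurable_snd)]
  filter_upwards [h.prior_s₂] with z hz
  rw [hz]
  exact ae_pos_invGamma α₂ γ₂

namespace RandomModel

lemma measurable_param (h : RandomModel P f₁ f₂ r₁ r₂ s₁ β₁ s₂ l Z₁ Z₂ δ) :
    Measurable fun ω => (s₁ ω, β₁ ω, s₂ ω, l ω) :=
  h.measurable_s₁.prodMk (h.measurable_β₁.prodMk (h.measurable_s₂.prodMk h.measurable_l))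

theorem hasCondDensity_sample_fst (h : RandomModel P f₁ f₂ r₁ r₂ s₁ β₁ s₂ l Z₁ Z₂ δ)
    (hR₁ : (corr r₁ x₁).PosDef) (hs₁ : ∀ᵐ ω ∂P, 0 < s₁ ω) :
    HasCondDensity P (sample Z₁ x₁) (fun ω => (s₁ ω, β₁ ω)) volume
      fun q u => gaussDensity (mulE (design f₁ x₁) q.2) (q.1 • corr r₁ x₁) u := by
  have hpos : ∀ᵐ θ ∂P.map (fun ω => (s₁ ω, β₁ ω, s₂ ω, l ω)), 0 < θ.1 :=
    (ae_map_iff h.measurable_param.aemeasurable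
      (measurableSet_lt measurable_const (by fun_prop))).2 hs₁
  have hL : Measurable fun q : (ℝ × EuclideanSpace ℝ (Fin p₁)) × EuclideanSpace ℝ (Fin n₁) =>
      gaussDensity (mulE (design f₁ x₁) q.1.2) (q.1.1 • corr r₁ x₁) q.2 :=
    measurable_gaussDensity_smul hR₁ (measurable_mulE (by fun_prop) (by fun_prop))
      (by fun_prop) (by fun_prop)
  refine HasCondDensity.comp_right (U := fun ω => (s₁ ω, β₁ ω, s₂ ω, l ω))
    (g := fun θ => (θ.1, θ.2.1)) (by fun_prop) hL ?_
  refine HasCondDensity.fst_of_condDistrib_eq_prod (measurable_sample h.measurable_Z₁ x₁)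
    (measurable_sample h.measurable_δ x₁) h.measurable_param (h.law n₁ n₁ x₁ x₁)
    (hL.comp (f := fun q : Param p₁ p₂ × EuclideanSpace ℝ (Fin n₁) => ((q.1.1, q.1.2.1), q.2))
      (by fun_prop)) ?_
  filter_upwards [hpos] with θ hθ using multivariateGaussian_eq_withDensity _ (hR₁.smul hθ)

theorem hasCondDensity_sample_snd (h : RandomModel P f₁ f₂ r₁ r₂ s₁ β₁ s₂ l Z₁ Z₂ δ)
    (he : ∀ i, x₂ i = x₁ (e i)) (hR₂ : (corr r₂ x₂).PosDef)
    (hs₂ : ∀ᵐ ω ∂P, 0 < s₂ ω) :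
    HasCondDensity P (sample Z₂ x₂) (fun ω => ((sample Z₁ x₁ ω, s₂ ω), l ω)) volume
      fun q z => gaussDensity (mulE (design₂ f₂ x₂ e q.1.1) q.2) (q.1.2 • corr r₂ x₂) z := by
  have hpos : ∀ᵐ θ ∂P.map (fun ω => (s₁ ω, β₁ ω, s₂ ω, l ω)), 0 < θ.2.2.1 :=
    (ae_map_iff h.measurable_param.aemeasurable
      (measurableSet_lt measurable_const (by fun_prop))).2 hs₂
  have hL : Measurable fun q : Param p₁ p₂ × EuclideanSpace ℝ (Fin n₂) =>
      gaussDensity (mulE (design f₂ x₂) (beta₂ q.1.2.2.2)) (q.1.2.2.1 • corr r₂ x₂) q.2 :=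
    measurable_gaussDensity_smul hR₂
      (measurable_mulE (by fun_prop) (measurable_beta₂.comp (by fun_prop)))
      (by fun_prop) (by fun_prop)
  have hδ := HasCondDensity.snd_of_condDistrib_eq_prod (τ := volume)
    (measurable_sample h.measurable_Z₁ x₁) (measurable_sample h.measurable_δ x₂)
    h.measurable_param (h.law n₁ n₂ x₁ x₂) hL
    (by filter_upwards [hpos] with θ hθ using multivariateGaussian_eq_withDensity _ (hR₂.smul hθ))
  have hc : Measurable fun q : Param p₁ p₂ × EuclideanSpace ℝ (Fin n₁) =>
      carry e q.2 q.1.2.2.2 :=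
    (measurable_carry e).comp
      (f := fun q : Param p₁ p₂ × EuclideanSpace ℝ (Fin n₁) => (q.2, q.1.2.2.2)) (by fun_prop)
  have hZ₂ := hδ.add_left hc
  simp only [← sample_autoregressive h.autoregressive he, gaussDensity_sub_carry] at hZ₂
  have hmean : Measurable fun q : ((EuclideanSpace ℝ (Fin n₁) × ℝ) ×
      EuclideanSpace ℝ (Unit ⊕ Fin p₂)) × EuclideanSpace ℝ (Fin n₂) =>
      mulE (design₂ f₂ x₂ e q.1.1.1) q.1.2 :=
    measurable_mulE (fun i j => (measurable_design₂ f₂ x₂ e i j).comp (by fun_prop)) (by fun_prop)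
  have hLsnd : Measurable fun q : ((EuclideanSpace ℝ (Fin n₁) × ℝ) ×
      EuclideanSpace ℝ (Unit ⊕ Fin p₂)) × EuclideanSpace ℝ (Fin n₂) =>
      gaussDensity (mulE (design₂ f₂ x₂ e q.1.1.1) q.1.2) (q.1.1.2 • corr r₂ x₂) q.2 :=
    measurable_gaussDensity_smul hR₂ hmean (by fun_prop) (by fun_prop)
  exact HasCondDensity.comp_right
    (U := fun ω => ((s₁ ω, β₁ ω, s₂ ω, l ω), sample Z₁ x₁ ω))
    (g := fun q => ((q.2, q.1.2.2.1), q.1.2.2.2))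
    (L := fun q z => gaussDensity (mulE (design₂ f₂ x₂ e q.1.1) q.2) (q.1.2 • corr r₂ x₂) z)
    (by fun_prop) hLsnd hZ₂

theorem condDistrib_β₁_ae_eq (h : RandomModel P f₁ f₂ r₁ r₂ s₁ β₁ s₂ l Z₁ Z₂ δ)
    (hprior : InformativePriors P s₁ β₁ s₂ l (sample Z₁ x₁) b₁ v₁ α₁ γ₁ bl vl α₂ γ₂)
    (hR₁ : (corr r₁ x₁).PosDef) (hv₁ : ∀ k, 0 < v₁ k) :
    ∀ᵐ y ∂P.map (fun ω => (sample Z₁ x₁ ω, s₁ ω)),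
      condDistrib β₁ (fun ω => (sample Z₁ x₁ ω, s₁ ω)) P y =
        multivariateGaussian
          (mulE (covI (design f₁ x₁) (corr r₁ x₁) (diagonal v₁) y.2)
            (nuI (design f₁ x₁) (corr r₁ x₁) (diagonal v₁) b₁ y.1 y.2))
          (covI (design f₁ x₁) (corr r₁ x₁) (diagonal v₁) y.2) := by
  have hpos := hprior.ae_pos_s₁
  have hZ := h.hasCondDensity_sample_fst hR₁ (ae_of_ae_map h.measurable_s₁.aemeasurable hpos)
  have hβ₁ := HasCondDensity.condDistrib_coeff_ae_eq (F := fun _ => design f₁ x₁)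
    (σ := fun s => s) hZ hR₁ (PosDef.diagonal hv₁) hpos hprior.prior_β₁
  exact condDistrib_ae_eq_of_comp_leftInverse (Y := fun ω => (sample Z₁ x₁ ω, s₁ ω))
    (e := fun y => (y.2, y.1)) (g := fun q => (q.2, q.1)) (by fun_prop) (by fun_prop) (fun _ => rfl)
    (hZ.measurable_left.prodMk h.measurable_s₁) h.measurable_β₁ hβ₁

theorem condDistrib_s₁_ae_eq (h : RandomModel P f₁ f₂ r₁ r₂ s₁ β₁ s₂ l Z₁ Z₂ δ)
    (hprior : InformativePriors P s₁ β₁ s₂ l (sample Z₁ x₁) b₁ v₁ α₁ γ₁ bl vl α₂ γ₂)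
    (hR₁ : (corr r₁ x₁).PosDef) (hv₁ : ∀ k, 0 < v₁ k) (hα₁ : 0 < α₁)
    (hγ₁ : 0 < γ₁) (hF : LinearIndependent ℝ (design f₁ x₁).col) :
    ∀ᵐ y ∂P.map (sample Z₁ x₁), condDistrib s₁ (sample Z₁ x₁) P y =
      invGamma ((n₁ : ℝ) / 2 + α₁)
        (scaleI (design f₁ x₁) (corr r₁ x₁) (diagonal v₁) b₁ γ₁ y / 2) := by
  have hpos := hprior.ae_pos_s₁
  have hV := PosDef.diagonal hv₁
  have hZ := h.hasCondDensity_sample_fst hR₁ (ae_of_ae_map h.measurable_s₁.aemeasurable hpos)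
  have hmarginal := HasCondDensity.integrate_coeff (F := fun _ => design f₁ x₁)
    (σ := fun s => s) hZ (by fun_prop) measurable_id hR₁ hV hpos hprior.prior_β₁
  simpa only [Fintype.card_fin] using
    hmarginal.condDistrib_variance_ae_eq_of_map hα₁ hγ₁ hR₁ hV hF hprior.prior_s₁

theorem condDistrib_l_ae_eq (h : RandomModel P f₁ f₂ r₁ r₂ s₁ β₁ s₂ l Z₁ Z₂ δ)
    (hprior : InformativePriors P s₁ β₁ s₂ l (sample Z₁ x₁) b₁ v₁ α₁ γ₁ bl vl α₂ γ₂)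
    (he : ∀ i, x₂ i = x₁ (e i)) (hR₂ : (corr r₂ x₂).PosDef)
    (hvl : ∀ k, 0 < vl k) :
    ∀ᵐ y ∂P.map (fun ω => (sample Z₁ x₁ ω, sample Z₂ x₂ ω, s₂ ω)),
      condDistrib l (fun ω => (sample Z₁ x₁ ω, sample Z₂ x₂ ω, s₂ ω)) P y =
        multivariateGaussian
          (mulE (covI (design₂ f₂ x₂ e y.1) (corr r₂ x₂) (diagonal vl) y.2.2)
            (nuI (design₂ f₂ x₂ e y.1) (corr r₂ x₂) (diagonal vl) bl y.2.1 y.2.2))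
          (covI (design₂ f₂ x₂ e y.1) (corr r₂ x₂) (diagonal vl) y.2.2) := by
  have hpos := hprior.ae_pos_s₂ h.measurable_s₂
  have hZ₁ := measurable_sample h.measurable_Z₁ x₁
  have hZ₂ := h.hasCondDensity_sample_snd he hR₂
    (ae_of_ae_map (hZ₁.prodMk h.measurable_s₂).aemeasurable hpos)
  have hl := HasCondDensity.condDistrib_coeff_ae_eq
    (F := fun u : EuclideanSpace ℝ (Fin n₁) × ℝ => design₂ f₂ x₂ e u.1) (σ := fun u => u.2)
    hZ₂ hR₂ (PosDef.diagonal hvl) hpos hprior.prior_l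
  exact condDistrib_ae_eq_of_comp_leftInverse
    (Y := fun ω => (sample Z₁ x₁ ω, sample Z₂ x₂ ω, s₂ ω))
    (e := fun y => ((y.1, y.2.2), y.2.1)) (g := fun q => (q.1.1, q.2, q.1.2))
    (by fun_prop) (by fun_prop) (fun _ => rfl)
    (hZ₁.prodMk (hZ₂.measurable_left.prodMk h.measurable_s₂)) h.measurable_l hl

theorem condDistrib_s₂_ae_eq (h : RandomModel P f₁ f₂ r₁ r₂ s₁ β₁ s₂ l Z₁ Z₂ δ)
    (hprior : InformativePriors P s₁ β₁ s₂ l (sample Z₁ x₁) b₁ v₁ α₁ γ₁ bl vl α₂ γ₂)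
    (he : ∀ i, x₂ i = x₁ (e i)) (hR₂ : (corr r₂ x₂).PosDef)
    (hvl : ∀ k, 0 < vl k) (hα₂ : 0 < α₂) (hγ₂ : 0 < γ₂) :
    ∀ᵐ y ∂P.map (fun ω => (sample Z₁ x₁ ω, sample Z₂ x₂ ω)),
      LinearIndependent ℝ (design₂ f₂ x₂ e y.1).col →
        condDistrib s₂ (fun ω => (sample Z₁ x₁ ω, sample Z₂ x₂ ω)) P y =
          invGamma ((n₂ : ℝ) / 2 + α₂)
            (scaleI (design₂ f₂ x₂ e y.1) (corr r₂ x₂) (diagonal vl) bl γ₂ y.2 / 2) := by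
  have hpos := hprior.ae_pos_s₂ h.measurable_s₂
  have hV := PosDef.diagonal hvl
  have hZ₁ := measurable_sample h.measurable_Z₁ x₁
  have hZ₂ := h.hasCondDensity_sample_snd he hR₂
    (ae_of_ae_map (hZ₁.prodMk h.measurable_s₂).aemeasurable hpos)
  have hdesign (i : Fin n₂) (j : Unit ⊕ Fin p₂) :
      Measurable fun u : EuclideanSpace ℝ (Fin n₁) × ℝ => design₂ f₂ x₂ e u.1 i j :=
    (measurable_design₂ f₂ x₂ e i j).comp measurable_fst
  have hmarginal := HasCondDensity.integrate_coeff
    (F := fun u : EuclideanSpace ℝ (Fin n₁) × ℝ => design₂ f₂ x₂ e u.1) (σ := fun u => u.2)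
    hZ₂ hdesign measurable_snd hR₂ hV hpos hprior.prior_l
  simpa only [Fintype.card_fin] using HasCondDensity.condDistrib_variance_ae_eq
    (F := design₂ f₂ x₂ e) hmarginal hα₂ hγ₂ hR₂ hV hprior.prior_s₂

end RandomModel

end Model

end CoKriging

end

theorem mainTheorem5
    {Ω : Type*} [MeasurableSpace Ω]
    {d p₁ p₂ n₁ n₂ : ℕ} (D : Set (EuclideanSpace ℝ (Fin d)))
    (f₁ : D → Fin p₁ → ℝ) (f₂ : D → Fin p₂ → ℝ)
    (r₁ r₂ : EuclideanSpace ℝ (Fin d) → ℝ)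
    (hr₁ : CoKriging.IsCorrelation D r₁) (hr₂ : CoKriging.IsCorrelation D r₂)
    (x₁ : Fin n₁ → D) (x₂ : Fin n₂ → D)
    (e : Fin n₂ → Fin n₁) (he : ∀ i, x₂ i = x₁ (e i))
    (F₁ : Matrix (Fin n₁) (Fin p₁) ℝ) (hF₁ : F₁ = CoKriging.design f₁ x₁)
    (F : EuclideanSpace ℝ (Fin n₁) → Matrix (Fin n₂) (Unit ⊕ Fin p₂) ℝ)
    (hF : F = CoKriging.design₂ f₂ x₂ e)
    (R₁ : Matrix (Fin n₁) (Fin n₁) ℝ) (hR₁ : R₁ = CoKriging.corr r₁ x₁) (hR₁pos : R₁.PosDef)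
    (R₂ : Matrix (Fin n₂) (Fin n₂) ℝ) (hR₂ : R₂ = CoKriging.corr r₂ x₂) (hR₂pos : R₂.PosDef) :
    -- Case (I): informative priors
    (∀ (b₁ : EuclideanSpace ℝ (Fin p₁)) (v₁ : Fin p₁ → ℝ) (α₁ γ₁ : ℝ)
        (bl : EuclideanSpace ℝ (Unit ⊕ Fin p₂)) (vl : Unit ⊕ Fin p₂ → ℝ) (α₂ γ₂ : ℝ),
      (∀ k, 0 < v₁ k) → (∀ k, 0 < vl k) → 0 < α₁ → 0 < γ₁ → 0 < α₂ → 0 < γ₂ →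
      ∀ (P : Measure Ω) [IsProbabilityMeasure P]
        (s₁ : Ω → ℝ) (β₁ : Ω → EuclideanSpace ℝ (Fin p₁))
        (s₂ : Ω → ℝ) (l : Ω → EuclideanSpace ℝ (Unit ⊕ Fin p₂)) (Z₁ Z₂ δ : D → Ω → ℝ)
        (z₁ : Ω → EuclideanSpace ℝ (Fin n₁)) (z₂ : Ω → EuclideanSpace ℝ (Fin n₂)),
      CoKriging.RandomModel P f₁ f₂ r₁ r₂ s₁ β₁ s₂ l Z₁ Z₂ δ →
      z₁ = CoKriging.sample Z₁ x₁ → z₂ = CoKriging.sample Z₂ x₂ →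
      CoKriging.InformativePriors P s₁ β₁ s₂ l z₁ b₁ v₁ α₁ γ₁ bl vl α₂ γ₂ →
      (∀ᵐ y ∂(P.map fun ω => (z₁ ω, s₁ ω)),
        condDistrib β₁ (fun ω => (z₁ ω, s₁ ω)) P y =
          multivariateGaussian
            (CoKriging.mulE (CoKriging.covI F₁ R₁ (Matrix.diagonal v₁) y.2)
              (CoKriging.nuI F₁ R₁ (Matrix.diagonal v₁) b₁ y.1 y.2))
            (CoKriging.covI F₁ R₁ (Matrix.diagonal v₁) y.2)) ∧
      (∀ᵐ y ∂(P.map fun ω => (z₁ ω, z₂ ω, s₂ ω)),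
        condDistrib l (fun ω => (z₁ ω, z₂ ω, s₂ ω)) P y =
          multivariateGaussian
            (CoKriging.mulE (CoKriging.covI (F y.1) R₂ (Matrix.diagonal vl) y.2.2)
              (CoKriging.nuI (F y.1) R₂ (Matrix.diagonal vl) bl y.2.1 y.2.2))
            (CoKriging.covI (F y.1) R₂ (Matrix.diagonal vl) y.2.2)) ∧
      (LinearIndependent ℝ F₁.col →
        ∀ᵐ y ∂(P.map z₁),
          condDistrib s₁ z₁ P y =
            CoKriging.invGamma ((n₁ : ℝ) / 2 + α₁)
              (CoKriging.scaleI F₁ R₁ (Matrix.diagonal v₁) b₁ γ₁ y / 2)) ∧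
      (∀ᵐ y ∂(P.map fun ω => (z₁ ω, z₂ ω)),
        LinearIndependent ℝ (F y.1).col →
          condDistrib s₂ (fun ω => (z₁ ω, z₂ ω)) P y =
            CoKriging.invGamma ((n₂ : ℝ) / 2 + α₂)
              (CoKriging.scaleI (F y.1) R₂ (Matrix.diagonal vl) bl γ₂ y.2 / 2))) ∧
    -- The likelihood: density of the observations, `p(z₁ | β₁, σ₁²) p(z₂ | z₁, ρ, β₂, σ₂²)`
    (∀ (s₁ : ℝ) (β₁ : EuclideanSpace ℝ (Fin p₁)) (s₂ : ℝ)
        (l : EuclideanSpace ℝ (Unit ⊕ Fin p₂)), 0 < s₁ → 0 < s₂ →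
      ∀ (P : Measure Ω) [IsProbabilityMeasure P] (Z₁ Z₂ δ : D → Ω → ℝ),
      CoKriging.FixedModel P f₁ f₂ r₁ r₂ (s₁, β₁, s₂, l) Z₁ Z₂ δ →
      P.map (fun ω => (CoKriging.sample Z₁ x₁ ω, CoKriging.sample Z₂ x₂ ω)) =
        volume.withDensity fun y => ENNReal.ofReal
          (CoKriging.gaussDensity (CoKriging.mulE F₁ β₁) (s₁ • R₁) y.1 *
            CoKriging.gaussDensity (CoKriging.mulE (F y.1) l) (s₂ • R₂) y.2)) ∧
    -- Case (II): non-informative priors, first level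
    (∀ z₁ : EuclideanSpace ℝ (Fin n₁), LinearIndependent ℝ F₁.col →
      (∀ s : ℝ, 0 < s →
        0 < CoKriging.evidence volume
          (fun β => CoKriging.gaussDensity (CoKriging.mulE F₁ β) (s • R₁) z₁) ∧
        CoKriging.evidence volume
          (fun β => CoKriging.gaussDensity (CoKriging.mulE F₁ β) (s • R₁) z₁) < ⊤ ∧
        CoKriging.bayes volume
            (fun β => CoKriging.gaussDensity (CoKriging.mulE F₁ β) (s • R₁) z₁) =
          multivariateGaussian
            (CoKriging.mulE (CoKriging.covII F₁ R₁ s) (CoKriging.nuII F₁ R₁ z₁ s))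
            (CoKriging.covII F₁ R₁ s)) ∧
      (z₁ ∉ Set.range (CoKriging.mulE F₁) →
        0 < CoKriging.evidence (volume.prod CoKriging.jeffreys)
          (fun q => CoKriging.gaussDensity (CoKriging.mulE F₁ q.1) (q.2 • R₁) z₁) ∧
        CoKriging.evidence (volume.prod CoKriging.jeffreys)
          (fun q => CoKriging.gaussDensity (CoKriging.mulE F₁ q.1) (q.2 • R₁) z₁) < ⊤ ∧
        (CoKriging.bayes (volume.prod CoKriging.jeffreys)
            (fun q => CoKriging.gaussDensity (CoKriging.mulE F₁ q.1) (q.2 • R₁) z₁)).map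
              Prod.snd =
          CoKriging.invGamma (((n₁ : ℝ) - p₁) / 2) (CoKriging.scaleII F₁ R₁ z₁ / 2))) ∧
    -- Case (II): non-informative priors, second level
    (∀ (z₁ : EuclideanSpace ℝ (Fin n₁)) (z₂ : EuclideanSpace ℝ (Fin n₂)),
      LinearIndependent ℝ (F z₁).col →
      (∀ s : ℝ, 0 < s →
        0 < CoKriging.evidence volume
          (fun l => CoKriging.gaussDensity (CoKriging.mulE (F z₁) l) (s • R₂) z₂) ∧
        CoKriging.evidence volume
          (fun l => CoKriging.gaussDensity (CoKriging.mulE (F z₁) l) (s • R₂) z₂) < ⊤ ∧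
        CoKriging.bayes volume
            (fun l => CoKriging.gaussDensity (CoKriging.mulE (F z₁) l) (s • R₂) z₂) =
          multivariateGaussian
            (CoKriging.mulE (CoKriging.covII (F z₁) R₂ s) (CoKriging.nuII (F z₁) R₂ z₂ s))
            (CoKriging.covII (F z₁) R₂ s)) ∧
      (z₂ ∉ Set.range (CoKriging.mulE (F z₁)) →
        0 < CoKriging.evidence (volume.prod CoKriging.jeffreys)
          (fun q => CoKriging.gaussDensity (CoKriging.mulE (F z₁) q.1) (q.2 • R₂) z₂) ∧
        CoKriging.evidence (volume.prod CoKriging.jeffreys)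
          (fun q => CoKriging.gaussDensity (CoKriging.mulE (F z₁) q.1) (q.2 • R₂) z₂) < ⊤ ∧
        (CoKriging.bayes (volume.prod CoKriging.jeffreys)
            (fun q => CoKriging.gaussDensity (CoKriging.mulE (F z₁) q.1) (q.2 • R₂) z₂)).map
              Prod.snd =
          CoKriging.invGamma (((n₂ : ℝ) - p₂ - 1) / 2)
            (CoKriging.scaleII (F z₁) R₂ z₂ / 2))) := by
  subst hF₁ hF hR₁ hR₂
  refine ⟨?_, ?_, ?_, ?_⟩
  · intro b₁ v₁ α₁ γ₁ bl vl α₂ γ₂ hv₁ hvl hα₁ hγ₁ hα₂ hγ₂ P _ s₁ β₁ s₂ l Z₁ Z₂ δ z₁ z₂ h hz₁ hz₂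
      hprior
    subst hz₁ hz₂
    exact ⟨h.condDistrib_β₁_ae_eq hprior hR₁pos hv₁, h.condDistrib_l_ae_eq hprior he hR₂pos hvl,
      h.condDistrib_s₁_ae_eq hprior hR₁pos hv₁ hα₁ hγ₁,
      h.condDistrib_s₂_ae_eq hprior he hR₂pos hvl hα₂ hγ₂⟩
  · intro s₁ β₁ s₂ l hs₁ hs₂ P _ Z₁ Z₂ δ h
    exact h.map_sample he hR₁pos hR₂pos hs₁ hs₂
  · intro z₁ hF₁
    refine ⟨fun s hs => CoKriging.bayes_volume hR₁pos hF₁ hs z₁, fun hz₁ => ?_⟩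
    simpa only [Fintype.card_fin] using CoKriging.bayes_prod_jeffreys hR₁pos hF₁ hz₁
  · intro z₁ z₂ hF
    refine ⟨fun s hs => CoKriging.bayes_volume hR₂pos hF hs z₂, fun hz₂ => ?_⟩
    have hcard : (n₂ : ℝ) - p₂ - 1 =
        Fintype.card (Fin n₂) - Fintype.card (Unit ⊕ Fin p₂) := by
      simp only [Fintype.card_sum, Fintype.card_unit, Fintype.card_fin, Nat.cast_add, Nat.cast_one]
      ring
    simpa only [hcard] using CoKriging.bayes_prod_jeffreys hR₂pos hF hz₂
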